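/- An *interval partition* of $[0,L]$, where $L\ge 0$, is a set $\beta$ of pairwise disjoint, nonempty open subintervals $(a,b)$ of $[0,L]$ that cover $[0,L]$ up to a Lebesgue-null set; write $\|\beta\|=L$ (which is determined by $\beta$), call the elements of $\beta$ *blocks*, and write $\mathrm{Leb}(U)$ for the length of a block $U$. Let $\mathcal I_H$ be the set of all interval partitions (of all intervals $[0,L]$, $L\ge 0$; the empty partition of $[0,0]$ is included). For $\beta,\gamma\in\mathcal I_H$, a *correspondence* between $\beta$ and $\gamma$ is a finite sequence of pairs of blocks $(U_1,V_1),\dots,(U_n,V_n)\in\beta\times\gamma$, $n\ge 0$, such that $(U_j)$ and $(V_j)$ are each strictly increasing in the left-to-right order. Let $d_H'(\beta,\gamma)$ be the infimum, over all correspondences between $\beta$ and $\gamma$, of $$\max\Big\{\sum_{j=1}^n|\mathrm{Leb}(U_j)-\mathrm{Leb}(V_j)|+\|\beta\|-\sum_{j=1}^n\mathrm{Leb}(U_j),\ \ \sum_{j=1}^n|\mathrm{Leb}(U_j)-\mathrm{Leb}(V_j)|+\|\gamma\|-\sum_{j=1}^n\mathrm{Leb}(V_j)\Big\}.$$ Let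 $d_H(\beta,\gamma)$ be the Hausdorff distance between the compact sets $[0,\|\beta\|]\setminus\bigcup_{U\in\beta}U$ and $[0,\|\gamma\|]\setminus\bigcup_{V\in\gamma}V$; this is a metric on $\mathcal I_H$. For $0<\alpha<1$, let $\mathcal I_\alpha$ be the set of those $\beta\in\mathcal I_H$ for which the limit $$\Gamma(1-\alpha)\lim_{h\downarrow 0}h^\alpha\,\#\{(a,b)\in\beta\colon b-a>h,\ b\le t\}$$ exists in $[0,\infty)$ for every $t\in[0,\|\beta\|]$. **Theorem.** (a) $d_H'$ is a metric on $\mathcal I_H$, with values in $[0,\infty)$. (b) $d_H$ and $d_H'$ generate the same topology on $\mathcal I_H$, and this topology is separable. (c) The metric space $(\mathcal I_H,d_H')$ is complete, while $(\mathcal I_H,d_H)$ is not complete. (d) For every $0<\alpha<1$, $\mathcal I_\alpha$ is a Borel subset of $\mathcal I_H$ and is dense in $\mathcal I_H$, for the topology of (b). -/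

import Mathlib

open Filter Topology MeasureTheory

noncomputable section

/-- An interval partition of `[0, mass]`: a set of pairwise disjoint nonempty open subintervals
of `[0, mass]` that cover `[0, mass]` up to a Lebesgue-null set. The block `(a, b)` is recorded
by the pair `(a, b)` of its endpoints, with `a < b`. The number `mass` (the `L` of `[0, L]`) is
determined by the blocks, so that two interval partitions with the same blocks are equal. -/
@[ext]
structure IntervalPartition where
  blocks : Set (ℝ × ℝ)
  mass : ℝ
  mass_nonneg : 0 ≤ mass
  lt_of_mem : ∀ U ∈ blocks, U.1 < U.2
  subset_of_mem : ∀ U ∈ blocks, Set.Ioo U.1 U.2 ⊆ Set.Icc 0 mass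
  pairwiseDisjoint : blocks.PairwiseDisjoint (fun U => Set.Ioo U.1 U.2)
  null_compl : volume (Set.Icc 0 mass \ ⋃ U ∈ blocks, Set.Ioo U.1 U.2) = 0

/-- The Lebesgue measure of the block with endpoints `U.1 < U.2`. -/
def blockLeb (U : ℝ × ℝ) : ℝ := U.2 - U.1

namespace IntervalPartition

/-- The complement `C_β = [0, ‖β‖] \ ⋃_{U ∈ β} U`. -/
def compl (β : IntervalPartition) : Set ℝ :=
  Set.Icc 0 β.mass \ ⋃ U ∈ β.blocks, Set.Ioo U.1 U.2

/-- The Hausdorff distance between the complements (nonempty compact sets). -/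
def dH (β γ : IntervalPartition) : ℝ := Metric.hausdorffDist β.compl γ.compl

/-- A correspondence between `β` and `γ`: a finite (possibly empty) sequence of pairs of blocks
`(U_j, V_j) ∈ β × γ` such that `(U_j)` and `(V_j)` are each strictly increasing from left
to right. -/
structure Correspondence (β γ : IntervalPartition) where
  n : ℕ
  U : Fin n → ℝ × ℝ
  V : Fin n → ℝ × ℝ
  U_mem : ∀ j, U j ∈ β.blocks
  V_mem : ∀ j, V j ∈ γ.blocks
  U_increasing : ∀ i j, i < j → (U i).2 ≤ (U j).1
  V_increasing : ∀ i j, i < j → (V i).2 ≤ (V j).1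

/-- The Hausdorff distortion of a correspondence. -/
def Correspondence.disH {β γ : IntervalPartition} (c : Correspondence β γ) : ℝ :=
  max
    (∑ j, |blockLeb (c.U j) - blockLeb (c.V j)| + β.mass - ∑ j, blockLeb (c.U j))
    (∑ j, |blockLeb (c.U j) - blockLeb (c.V j)| + γ.mass - ∑ j, blockLeb (c.V j))

/-- The correspondence-based distance: the infimum of the distortions of all correspondences.
The infimum is over a nonempty family of nonnegative numbers. -/
def dH' (β γ : IntervalPartition) : ℝ := ⨅ c : Correspondence β γ, c.disH

/-- The number of blocks `(a, b)` of `β` with `b - a > h` and `b ≤ t` (finite for `h > 0`). -/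
def blockCount (β : IntervalPartition) (h t : ℝ) : ℕ :=
  {U ∈ β.blocks | h < U.2 - U.1 ∧ U.2 ≤ t}.ncard

/-- `D` is the `α`-diversity of `β` up to `t`, i.e. the limit
`Γ(1 - α) lim_{h ↓ 0} h ^ α #{(a, b) ∈ β : b - a > h, b ≤ t}` exists and equals `D`. -/
def HasDiversity (α : ℝ) (β : IntervalPartition) (t D : ℝ) : Prop :=
  Tendsto (fun h : ℝ => Real.Gamma (1 - α) * (h ^ α * (β.blockCount h t : ℝ)))
    (𝓝[>] 0) (𝓝 D)

/-- The set `I_α` of interval partitions with the `α`-diversity property. -/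
def withDiversity (α : ℝ) : Set IntervalPartition :=
  {β | ∀ t ∈ Set.Icc 0 β.mass, ∃ D : ℝ, HasDiversity α β t D}

end IntervalPartition

/-- `d` is a metric on `X`, with values in `[0, ∞)`. -/
structure IsMetric {X : Type*} (d : X → X → ℝ) : Prop where
  nonneg : ∀ x y, 0 ≤ d x y
  self : ∀ x, d x x = 0
  eq_of_zero : ∀ x y, d x y = 0 → x = y
  symm : ∀ x y, d x y = d y x
  triangle : ∀ x y z, d x z ≤ d x y + d y z

/-- The metric space `(X, d)`. -/
@[reducible]
def IsMetric.toMetricSpace {X : Type*} {d : X → X → ℝ} (hd : IsMetric d) : MetricSpace X where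
  dist := d
  dist_self := hd.self
  dist_comm := hd.symm
  dist_triangle := hd.triangle
  eq_of_dist_eq_zero := fun {x y} h => hd.eq_of_zero x y h

/-- The topology generated by the metric `d`. -/
@[reducible]
def IsMetric.topology {X : Type*} {d : X → X → ℝ} (hd : IsMetric d) : TopologicalSpace X :=
  hd.toMetricSpace.toUniformSpace.toTopologicalSpace

/-- The metric space `(X, d)` is complete. -/
def IsMetric.IsComplete {X : Type*} {d : X → X → ℝ} (hd : IsMetric d) : Prop :=
  @CompleteSpace X hd.toMetricSpace.toUniformSpace

end

/-! Correspondences are handled as finite order-preserving sets of pairs of blocks. Two of them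
compose through the blocks of the middle partition that they share; the middle blocks used only by
the first are disjoint from those used by the second, so all of them fit into the middle mass, and
this gives the triangle inequality (`sum_abs_sub_sum_comp_le`). Cutting a matching at a point of one
complement yields a nearby point of the other, so `dH ≤ dH'` (`dH_le_dH'`), which also gives
definiteness.

Conversely, finitely many blocks carry almost all the mass of `β`, and they persist in order in any
partition that is Hausdorff-close to `β` (`exists_dH'_lt_of_dH_lt`). The topologies therefore agree,
and separability comes from the space of nonempty compact subsets of the line.

The Hausdorff limit of a sequence of complements may have positive measure: finer and finer grids
tend to `[0, 1]`, so `dH` is not complete. A `dH'`-Cauchy sequence excludes this, because a bounded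
number of blocks carries almost all the mass of every late term (`exists_finset_of_dH'_lt`), which
makes the limit null (`volume_le_of_dist_lt`).

Density follows from finite nets of the complement. For the Borel property, uncountably many `t`
must be controlled. Convergence at rational `t` is a Borel condition and, by monotonicity,
convergence can then fail only at a jump of the limit. The failures form countably many Borel sets
of pairs `(β, t)` with at most one `t` over each `β`; by Lusin–Souslin, which needs the Polish
topology from completeness and separability, their projections are Borel. -/

/-! ### Lengths of finite families of disjoint open intervals -/

/-- A measurable set and finitely many pairwise disjoint open intervals, disjoint from that set,
all inside `[s, t]`, have total length at most `t - s`. -/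
theorem volume_add_sum_blockLeb_le {s t : ℝ} {C : Set ℝ} {ι : Type*} {F : Finset ι}
    {W : ι → ℝ × ℝ} (hCs : C ⊆ Set.Icc s t) (hlt : ∀ i ∈ F, (W i).1 ≤ (W i).2)
    (hdis : (F : Set ι).PairwiseDisjoint (fun i => Set.Ioo (W i).1 (W i).2))
    (hCdis : ∀ i ∈ F, Disjoint C (Set.Ioo (W i).1 (W i).2))
    (hF : ∀ i ∈ F, Set.Ioo (W i).1 (W i).2 ⊆ Set.Icc s t) :
    volume C + ENNReal.ofReal (∑ i ∈ F, blockLeb (W i)) ≤ ENNReal.ofReal (t - s) := by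
  have h1 : ENNReal.ofReal (∑ i ∈ F, blockLeb (W i))
      = volume (⋃ i ∈ F, Set.Ioo (W i).1 (W i).2) := by
    rw [measure_biUnion_finset hdis (fun _ _ => measurableSet_Ioo),
      ENNReal.ofReal_sum_of_nonneg (f := fun i => blockLeb (W i))
        (fun i hi => sub_nonneg.2 (hlt i hi))]
    exact Finset.sum_congr rfl fun i _ => by rw [Real.volume_Ioo, blockLeb]
  rw [h1, ← measure_union _ (Finset.measurableSet_biUnion _ fun _ _ => measurableSet_Ioo),
    ← Real.volume_Icc]
  · exact measure_mono (Set.union_subset hCs (Set.iUnion₂_subset hF))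
  · exact Set.disjoint_iUnion₂_right.2 hCdis

theorem sum_blockLeb_le {s t : ℝ} (hst : s ≤ t) {ι : Type*} {F : Finset ι} {W : ι → ℝ × ℝ}
    (hlt : ∀ i ∈ F, (W i).1 ≤ (W i).2)
    (hdis : (F : Set ι).PairwiseDisjoint (fun i => Set.Ioo (W i).1 (W i).2))
    (hF : ∀ i ∈ F, Set.Ioo (W i).1 (W i).2 ⊆ Set.Icc s t) :
    ∑ i ∈ F, blockLeb (W i) ≤ t - s := by
  have := volume_add_sum_blockLeb_le (C := ∅) (Set.empty_subset _) hlt hdis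
    (fun _ _ => Set.empty_disjoint _) hF
  rw [measure_empty, zero_add] at this
  exact (ENNReal.ofReal_le_ofReal_iff (sub_nonneg.2 hst)).1 this

namespace IntervalPartition

variable {β γ δ : IntervalPartition} {U V : ℝ × ℝ}

/-! ### Blocks and the complement -/

theorem Icc_subset (β : IntervalPartition) {U : ℝ × ℝ} (hU : U ∈ β.blocks) :
    Set.Icc U.1 U.2 ⊆ Set.Icc 0 β.mass := by
  rw [← closure_Ioo (β.lt_of_mem U hU).ne]
  exact isClosed_Icc.closure_subset_iff.2 (β.subset_of_mem U hU)

theorem fst_nonneg (hU : U ∈ β.blocks) : 0 ≤ U.1 :=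
  (β.Icc_subset hU (Set.left_mem_Icc.2 (β.lt_of_mem U hU).le)).1

theorem snd_le_mass (hU : U ∈ β.blocks) : U.2 ≤ β.mass :=
  (β.Icc_subset hU (Set.right_mem_Icc.2 (β.lt_of_mem U hU).le)).2

theorem blockLeb_pos (hU : U ∈ β.blocks) : 0 < blockLeb U :=
  sub_pos.2 (β.lt_of_mem U hU)

theorem snd_le_fst_or (hU : U ∈ β.blocks) (hV : V ∈ β.blocks) (hUV : U ≠ V) :
    U.2 ≤ V.1 ∨ V.2 ≤ U.1 := by
  have h := Set.Ioo_disjoint_Ioo.1 (β.pairwiseDisjoint hU hV hUV)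
  have h1 := β.lt_of_mem U hU
  have h2 := β.lt_of_mem V hV
  rcases min_le_iff.1 h with h | h <;> rcases le_max_iff.1 h with h | h
  · linarith
  · exact .inl h
  · exact .inr h
  · linarith

theorem mem_compl_iff {x : ℝ} :
    x ∈ β.compl ↔ (0 ≤ x ∧ x ≤ β.mass) ∧ ∀ U ∈ β.blocks, U.1 < x → U.2 ≤ x := by
  simp only [compl, Set.mem_sdiff, Set.mem_Icc, Set.mem_iUnion, Set.mem_Ioo, exists_prop, not_exists,
    not_and, not_lt]

theorem isCompact_compl (β : IntervalPartition) : IsCompact β.compl :=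
  isCompact_Icc.diff (isOpen_biUnion fun _ _ => isOpen_Ioo)

theorem zero_mem_compl (β : IntervalPartition) : 0 ∈ β.compl :=
  mem_compl_iff.2 ⟨⟨le_rfl, β.mass_nonneg⟩, fun _ hU h => absurd h (fst_nonneg hU).not_gt⟩

theorem mass_mem_compl (β : IntervalPartition) : β.mass ∈ β.compl :=
  mem_compl_iff.2 ⟨⟨β.mass_nonneg, le_rfl⟩, fun _ hU _ => snd_le_mass hU⟩

theorem fst_mem_compl (hU : U ∈ β.blocks) : U.1 ∈ β.compl := by
  have h1 := β.lt_of_mem U hU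
  refine mem_compl_iff.2 ⟨⟨fst_nonneg hU, h1.le.trans (snd_le_mass hU)⟩, fun V hV h => ?_⟩
  rcases eq_or_ne U V with rfl | hne
  · exact absurd h (lt_irrefl _)
  · rcases snd_le_fst_or hU hV hne with h2 | h2 <;> linarith

theorem snd_mem_compl (hU : U ∈ β.blocks) : U.2 ∈ β.compl := by
  have h1 := β.lt_of_mem U hU
  refine mem_compl_iff.2 ⟨⟨(fst_nonneg hU).trans h1.le, snd_le_mass hU⟩, fun V hV h => ?_⟩
  rcases eq_or_ne U V with rfl | hne
  · exact le_rfl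
  · rcases snd_le_fst_or hU hV hne with h2 | h2 <;> linarith

theorem le_fst_or_snd_le {x : ℝ} (hU : U ∈ β.blocks) (hx : x ∈ β.compl) :
    x ≤ U.1 ∨ U.2 ≤ x :=
  (le_or_gt x U.1).imp_right ((mem_compl_iff.1 hx).2 U hU)

theorem exists_block_of_notMem_compl {x : ℝ} (h0 : 0 ≤ x) (h1 : x ≤ β.mass) (hx : x ∉ β.compl) :
    ∃ U ∈ β.blocks, U.1 < x ∧ x < U.2 := by
  by_contra! h
  exact hx (mem_compl_iff.2 ⟨⟨h0, h1⟩, h⟩)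

/-- The blocks are the gaps of the complement. -/
theorem mem_blocks_iff : U ∈ β.blocks ↔
    U.1 ∈ β.compl ∧ U.2 ∈ β.compl ∧ U.1 < U.2 ∧ ∀ x ∈ β.compl, x ≤ U.1 ∨ U.2 ≤ x := by
  refine ⟨fun h => ⟨fst_mem_compl h, snd_mem_compl h, β.lt_of_mem U h,
    fun x hx => le_fst_or_snd_le h hx⟩, fun ⟨h1, h2, h3, h4⟩ => ?_⟩
  -- The midpoint of the gap lies in some block, whose endpoints are then forced to be those of the
  -- gap.
  have hm : (U.1 + U.2) / 2 ∉ β.compl := fun h => by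
    rcases h4 _ h with h | h <;> linarith
  obtain ⟨V, hV, hV1, hV2⟩ := exists_block_of_notMem_compl
    (by linarith [(mem_compl_iff.1 h1).1.1]) (by linarith [(mem_compl_iff.1 h2).1.2]) hm
  have e1 : V.1 = U.1 := by
    rcases h4 _ (fst_mem_compl hV) with h | h <;>
      rcases le_fst_or_snd_le hV h1 with h' | h' <;> linarith
  have e2 : V.2 = U.2 := by
    rcases h4 _ (snd_mem_compl hV) with h | h <;>
      rcases le_fst_or_snd_le hV h2 with h' | h' <;> linarith
  rwa [← Prod.ext e1 e2]

/-- The blocks are the gaps of the complement and the mass is its largest point. -/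
theorem compl_injective : Function.Injective compl := by
  intro β γ h
  ext U
  · rw [mem_blocks_iff, mem_blocks_iff, h]
  · refine le_antisymm ?_ ?_
    · exact (mem_compl_iff.1 (h ▸ β.mass_mem_compl)).1.2
    · exact (mem_compl_iff.1 (h.symm ▸ γ.mass_mem_compl)).1.2

/-- The complement as a nonempty compact set. -/
def complNonemptyCompacts (β : IntervalPartition) : TopologicalSpace.NonemptyCompacts ℝ where
  carrier := β.compl
  isCompact' := β.isCompact_compl
  nonempty' := ⟨0, β.zero_mem_compl⟩

theorem dist_complNonemptyCompacts (β γ : IntervalPartition) :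
    dist β.complNonemptyCompacts γ.complNonemptyCompacts = dH β γ := rfl

theorem complNonemptyCompacts_injective : Function.Injective complNonemptyCompacts :=
  fun _ _ h => compl_injective (congrArg (fun K : TopologicalSpace.NonemptyCompacts ℝ =>
    (K : Set ℝ)) h)

theorem isMetric_dH : IsMetric dH where
  nonneg _ _ := Metric.hausdorffDist_nonneg
  self _ := Metric.hausdorffDist_self_zero
  eq_of_zero _ _ h := complNonemptyCompacts_injective (eq_of_dist_eq_zero h)
  symm _ _ := Metric.hausdorffDist_comm
  triangle β γ δ :=
    dist_triangle β.complNonemptyCompacts γ.complNonemptyCompacts δ.complNonemptyCompacts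

/-! ### The interval partition with a given complement -/

/-- Compactness provides a last point of `C` before `x` and a first one after it. -/
theorem exists_gap {C : Set ℝ} (hC : IsCompact C) (h0 : 0 ∈ C) {x : ℝ} (hx0 : 0 ≤ x)
    (hxC : x ∉ C) {y : ℝ} (hy : y ∈ C) (hxy : x ≤ y) :
    ∃ a ∈ C, ∃ b ∈ C, a < x ∧ x < b ∧ ∀ z ∈ C, z ≤ a ∨ b ≤ z := by
  obtain ⟨a, ⟨haC, hax⟩, ha⟩ := (hC.inter_right (isClosed_Iic (a := x))).exists_isGreatest
    ⟨0, h0, hx0⟩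
  obtain ⟨b, ⟨hbC, hbx⟩, hb⟩ := (hC.inter_right (isClosed_Ici (a := x))).exists_isLeast
    ⟨y, hy, hxy⟩
  refine ⟨a, haC, b, hbC, lt_of_le_of_ne hax fun h => hxC (h ▸ haC),
    lt_of_le_of_ne hbx fun h => hxC (h ▸ hbC), fun z hz => ?_⟩
  exact (le_total z x).imp (fun h => ha ⟨hz, h⟩) (fun h => hb ⟨hz, h⟩)

/-- The gaps of a compact set, as pairs of endpoints. -/
def gaps (C : Set ℝ) : Set (ℝ × ℝ) :=
  {U | U.1 ∈ C ∧ U.2 ∈ C ∧ U.1 < U.2 ∧ ∀ x ∈ C, x ≤ U.1 ∨ U.2 ≤ x}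

theorem Icc_diff_iUnion_gaps {C : Set ℝ} (hC : IsCompact C) (h0 : 0 ∈ C) (hnn : C ⊆ Set.Ici 0) :
    Set.Icc 0 (sSup C) \ ⋃ U ∈ gaps C, Set.Ioo U.1 U.2 = C := by
  ext x
  constructor
  · rintro ⟨⟨hx0, hx1⟩, hx⟩
    by_contra hxC
    obtain ⟨a, ha, b, hb, hax, hxb, h⟩ :=
      exists_gap hC h0 hx0 hxC (hC.sSup_mem ⟨0, h0⟩) hx1
    exact hx (Set.mem_biUnion (x := (a, b)) ⟨ha, hb, hax.trans hxb, h⟩ ⟨hax, hxb⟩)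
  · refine fun hx => ⟨⟨hnn hx, le_csSup hC.bddAbove hx⟩, fun h => ?_⟩
    obtain ⟨U, hU, h1, h2⟩ := Set.mem_iUnion₂.1 h
    rcases hU.2.2.2 x hx with h | h <;> linarith

/-- The interval partition whose complement is a given Lebesgue-null compact set. -/
noncomputable def ofCompact (C : Set ℝ) (hC : IsCompact C) (h0 : 0 ∈ C) (hnn : C ⊆ Set.Ici 0)
    (hvol : volume C = 0) : IntervalPartition where
  blocks := gaps C
  mass := sSup C
  mass_nonneg := le_csSup hC.bddAbove h0
  lt_of_mem U hU := hU.2.2.1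
  subset_of_mem U hU x hx :=
    ⟨(hnn hU.1).trans hx.1.le, hx.2.le.trans (le_csSup hC.bddAbove hU.2.1)⟩
  pairwiseDisjoint U hU V hV hUV := by
    refine Set.disjoint_left.2 fun x hxU hxV => hUV ?_
    have e1 : U.1 = V.1 := le_antisymm
      ((hV.2.2.2 _ hU.1).resolve_right (by linarith [hxU.1, hxV.2]))
      ((hU.2.2.2 _ hV.1).resolve_right (by linarith [hxV.1, hxU.2]))
    have e2 : U.2 = V.2 := le_antisymm
      ((hU.2.2.2 _ hV.2.1).resolve_left (by linarith [hxU.1, hxV.2]))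
      ((hV.2.2.2 _ hU.2.1).resolve_left (by linarith [hxV.1, hxU.2]))
    exact Prod.ext e1 e2
  null_compl := by rw [Icc_diff_iUnion_gaps hC h0 hnn, hvol]

theorem compl_ofCompact {C : Set ℝ} (hC : IsCompact C) (h0 : 0 ∈ C) (hnn : C ⊆ Set.Ici 0)
    (hvol : volume C = 0) : (ofCompact C hC h0 hnn hvol).compl = C :=
  Icc_diff_iUnion_gaps hC h0 hnn

/-! ### Sums of block lengths -/

theorem sum_blockLeb_le_sub {F : Finset (ℝ × ℝ)} (hF : ∀ U ∈ F, U ∈ β.blocks) {s t : ℝ}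
    (hst : s ≤ t) (hs : ∀ U ∈ F, s ≤ U.1) (ht : ∀ U ∈ F, U.2 ≤ t) :
    ∑ U ∈ F, blockLeb U ≤ t - s :=
  sum_blockLeb_le hst (fun U hU => (β.lt_of_mem U (hF U hU)).le)
    (β.pairwiseDisjoint.subset hF)
    (fun U hU => Set.Ioo_subset_Icc_self.trans (Set.Icc_subset_Icc (hs U hU) (ht U hU)))

theorem sum_blockLeb_le_mass {F : Finset (ℝ × ℝ)} (hF : ∀ U ∈ F, U ∈ β.blocks) :
    ∑ U ∈ F, blockLeb U ≤ β.mass := by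
  simpa using sum_blockLeb_le_sub hF β.mass_nonneg (fun U hU => fst_nonneg (hF U hU))
    (fun U hU => snd_le_mass (hF U hU))

theorem countable_blocks (β : IntervalPartition) : β.blocks.Countable :=
  β.pairwiseDisjoint.countable_of_isOpen (fun _ _ => isOpen_Ioo)
    (fun U hU => Set.nonempty_Ioo.2 (β.lt_of_mem U hU))

/-- Finitely many blocks exhaust the mass up to `ε`. -/
theorem exists_finset_lt_sum (β : IntervalPartition) {ε : ℝ} (hε : 0 < ε) :
    ∃ F : Finset (ℝ × ℝ), (∀ U ∈ F, U ∈ β.blocks) ∧ β.mass - ε < ∑ U ∈ F, blockLeb U := by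
  -- A negative target is split off because `ENNReal.ofReal` would truncate it.
  rcases lt_or_ge (β.mass - ε) 0 with hneg | hnn
  · exact ⟨∅, by simp, by simpa using hneg⟩
  have hsub : (⋃ U ∈ β.blocks, Set.Ioo U.1 U.2) ⊆ Set.Icc 0 β.mass :=
    Set.iUnion₂_subset β.subset_of_mem
  have h1 : ENNReal.ofReal β.mass = ∑' U : β.blocks, ENNReal.ofReal (blockLeb U) := by
    have h2 : volume (⋃ U ∈ β.blocks, Set.Ioo U.1 U.2) = volume (Set.Icc 0 β.mass) :=
      measure_eq_measure_of_null_sdiff hsub β.null_compl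
    rw [measure_biUnion β.countable_blocks β.pairwiseDisjoint (fun _ _ => measurableSet_Ioo),
      Real.volume_Icc, sub_zero] at h2
    rw [← h2]
    exact tsum_congr fun U => by rw [Real.volume_Ioo, blockLeb]
  have h3 : ENNReal.ofReal (β.mass - ε) < ⨆ s : Finset β.blocks,
      ∑ U ∈ s, ENNReal.ofReal (blockLeb U) := by
    rw [← ENNReal.tsum_eq_iSup_sum, ← h1]
    exact (ENNReal.ofReal_lt_ofReal_iff (by linarith)).2 (by linarith)
  obtain ⟨s, hs⟩ := lt_iSup_iff.1 h3
  refine ⟨s.map (Function.Embedding.subtype _), fun U hU => ?_, ?_⟩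
  · obtain ⟨V, -, rfl⟩ := Finset.mem_map.1 hU
    exact V.2
  · rw [Finset.sum_map]
    rw [← ENNReal.ofReal_sum_of_nonneg (fun U _ => (blockLeb_pos U.2).le)] at hs
    exact (ENNReal.ofReal_lt_ofReal_iff_of_nonneg hnn).1 hs

end IntervalPartition

namespace IntervalPartition

variable {β γ δ : IntervalPartition} {U V : ℝ × ℝ} {S T : Finset ((ℝ × ℝ) × (ℝ × ℝ))}

/-! ### Matchings: correspondences as finite sets of pairs -/

/-- A correspondence, recorded as the finite set of its pairs of blocks. -/
structure IsMatching (β γ : IntervalPartition) (S : Finset ((ℝ × ℝ) × (ℝ × ℝ))) : Prop where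
  fst_mem : ∀ p ∈ S, p.1 ∈ β.blocks
  snd_mem : ∀ p ∈ S, p.2 ∈ γ.blocks
  ordered : ∀ p ∈ S, ∀ q ∈ S, p ≠ q →
    (p.1.2 ≤ q.1.1 ∧ p.2.2 ≤ q.2.1) ∨ (q.1.2 ≤ p.1.1 ∧ q.2.2 ≤ p.2.1)

/-- The distortion of a matching. -/
noncomputable def matchingCost (β γ : IntervalPartition) (S : Finset ((ℝ × ℝ) × (ℝ × ℝ))) : ℝ :=
  max (∑ p ∈ S, |blockLeb p.1 - blockLeb p.2| + β.mass - ∑ p ∈ S, blockLeb p.1)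
    (∑ p ∈ S, |blockLeb p.1 - blockLeb p.2| + γ.mass - ∑ p ∈ S, blockLeb p.2)

namespace IsMatching

theorem injOn_fst_fst (h : IsMatching β γ S) :
    ∀ p ∈ S, ∀ q ∈ S, p.1.1 = q.1.1 → p = q := by
  intro p hp q hq hpq
  by_contra hne
  have h1 := β.lt_of_mem _ (h.fst_mem p hp)
  have h2 := β.lt_of_mem _ (h.fst_mem q hq)
  rcases h.ordered p hp q hq hne with h' | h' <;> linarith [h'.1]

theorem injOn_snd_fst (h : IsMatching β γ S) :
    ∀ p ∈ S, ∀ q ∈ S, p.2.1 = q.2.1 → p = q := by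
  intro p hp q hq hpq
  by_contra hne
  have h1 := γ.lt_of_mem _ (h.snd_mem p hp)
  have h2 := γ.lt_of_mem _ (h.snd_mem q hq)
  rcases h.ordered p hp q hq hne with h' | h' <;> linarith [h'.2]

theorem injOn_fst (h : IsMatching β γ S) : ∀ p ∈ S, ∀ q ∈ S, p.1 = q.1 → p = q :=
  fun p hp q hq hpq => h.injOn_fst_fst p hp q hq (congrArg Prod.fst hpq)

theorem injOn_snd (h : IsMatching β γ S) : ∀ p ∈ S, ∀ q ∈ S, p.2 = q.2 → p = q :=
  fun p hp q hq hpq => h.injOn_snd_fst p hp q hq (congrArg Prod.fst hpq)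

theorem mono (h : IsMatching β γ S) (hTS : T ⊆ S) : IsMatching β γ T :=
  ⟨fun p hp => h.fst_mem p (hTS hp), fun p hp => h.snd_mem p (hTS hp),
    fun p hp q hq => h.ordered p (hTS hp) q (hTS hq)⟩

theorem sum_fst_le (h : IsMatching β γ S) {s t : ℝ} (hst : s ≤ t)
    (hs : ∀ p ∈ S, s ≤ p.1.1) (ht : ∀ p ∈ S, p.1.2 ≤ t) :
    ∑ p ∈ S, blockLeb p.1 ≤ t - s := by
  rw [← Finset.sum_image (f := blockLeb) (g := Prod.fst) h.injOn_fst]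
  exact sum_blockLeb_le_sub (β := β) (by simpa using fun a b c d hp => h.fst_mem _ hp) hst
    (by simpa using fun a b c d hp => hs _ hp) (by simpa using fun a b c d hp => ht _ hp)

theorem sum_snd_le (h : IsMatching β γ S) {s t : ℝ} (hst : s ≤ t)
    (hs : ∀ p ∈ S, s ≤ p.2.1) (ht : ∀ p ∈ S, p.2.2 ≤ t) :
    ∑ p ∈ S, blockLeb p.2 ≤ t - s := by
  rw [← Finset.sum_image (f := blockLeb) (g := Prod.snd) h.injOn_snd]
  exact sum_blockLeb_le_sub (β := γ) (by simpa using fun a b c d hp => h.snd_mem _ hp) hst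
    (by simpa using fun a b c d hp => hs _ hp) (by simpa using fun a b c d hp => ht _ hp)

theorem sum_fst_le_mass (h : IsMatching β γ S) : ∑ p ∈ S, blockLeb p.1 ≤ β.mass := by
  simpa using h.sum_fst_le β.mass_nonneg (fun p hp => fst_nonneg (h.fst_mem p hp))
    (fun p hp => snd_le_mass (h.fst_mem p hp))

theorem cost_nonneg (h : IsMatching β γ S) : 0 ≤ matchingCost β γ S := by
  refine le_max_of_le_left ?_
  have := Finset.sum_nonneg (s := S) (fun p _ => abs_nonneg (blockLeb p.1 - blockLeb p.2))
  linarith [h.sum_fst_le_mass]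

theorem swap (h : IsMatching β γ S) : IsMatching γ β (S.image Prod.swap) := by
  refine ⟨?_, ?_, ?_⟩
  · rintro p hp
    obtain ⟨q, hq, rfl⟩ := Finset.mem_image.1 hp
    exact h.snd_mem q hq
  · rintro p hp
    obtain ⟨q, hq, rfl⟩ := Finset.mem_image.1 hp
    exact h.fst_mem q hq
  · rintro p hp q hq hne
    obtain ⟨p, hpS, rfl⟩ := Finset.mem_image.1 hp
    obtain ⟨q, hqS, rfl⟩ := Finset.mem_image.1 hq
    exact (h.ordered p hpS q hqS (fun e => hne (e ▸ rfl))).imp And.symm And.symm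

end IsMatching

theorem matchingCost_swap (β γ : IntervalPartition) (S : Finset ((ℝ × ℝ) × (ℝ × ℝ))) :
    matchingCost γ β (S.image Prod.swap) = matchingCost β γ S := by
  simp only [matchingCost, Finset.sum_image Prod.swap_injective.injOn, Prod.fst_swap,
    Prod.snd_swap]
  rw [max_comm]
  simp only [abs_sub_comm]

/-- With the converse below, this allows all estimates to be made on finite sets of pairs, where
restriction, reversal and composition need no reindexing. -/
theorem Correspondence.exists_isMatching (c : Correspondence β γ) :
    ∃ S, IsMatching β γ S ∧ matchingCost β γ S = c.disH := by
  have hinj : Function.Injective (fun j => (c.U j, c.V j)) := by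
    intro i j hij
    have h1 : c.U i = c.U j := congrArg Prod.fst hij
    by_contra hne
    have h2 := β.lt_of_mem _ (c.U_mem j)
    rcases lt_or_gt_of_ne hne with h | h
    · have := c.U_increasing i j h
      rw [h1] at this
      linarith
    · have := c.U_increasing j i h
      rw [h1] at this
      linarith
  refine ⟨Finset.univ.image (fun j => (c.U j, c.V j)), ⟨?_, ?_, ?_⟩, ?_⟩
  · rintro p hp
    obtain ⟨j, -, rfl⟩ := Finset.mem_image.1 hp
    exact c.U_mem j
  · rintro p hp
    obtain ⟨j, -, rfl⟩ := Finset.mem_image.1 hp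
    exact c.V_mem j
  · rintro p hp q hq hne
    obtain ⟨i, -, rfl⟩ := Finset.mem_image.1 hp
    obtain ⟨j, -, rfl⟩ := Finset.mem_image.1 hq
    rcases lt_trichotomy i j with h | h | h
    · exact .inl ⟨c.U_increasing i j h, c.V_increasing i j h⟩
    · exact absurd (h ▸ rfl) hne
    · exact .inr ⟨c.U_increasing j i h, c.V_increasing j i h⟩
  · simp only [matchingCost, Correspondence.disH, Finset.sum_image hinj.injOn]

/-- The left endpoint of the first block identifies a pair, so sorting these endpoints enumerates
the matching from left to right. -/
theorem IsMatching.exists_correspondence (h : IsMatching β γ S) :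
    ∃ c : Correspondence β γ, c.disH = matchingCost β γ S := by
  let A := S.image (fun p => p.1.1)
  let e := A.orderEmbOfFin rfl
  have hg : ∀ j, ∃ p ∈ S, p.1.1 = e j := fun j =>
    Finset.mem_image.1 (A.orderEmbOfFin_mem rfl j)
  choose g hgS hge using hg
  have hlt : ∀ i j, i < j → (g i).1.2 ≤ (g j).1.1 ∧ (g i).2.2 ≤ (g j).2.1 := by
    intro i j hij
    have h1 : (g i).1.1 < (g j).1.1 := by rw [hge, hge]; exact e.strictMono hij
    refine (h.ordered _ (hgS i) _ (hgS j) (fun e => by rw [e] at h1; exact lt_irrefl _ h1)).resolve_right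
      fun h' => ?_
    linarith [h'.1, β.lt_of_mem _ (h.fst_mem _ (hgS j))]
  have hsum : ∀ f : (ℝ × ℝ) × (ℝ × ℝ) → ℝ, ∑ j, f (g j) = ∑ p ∈ S, f p := by
    intro f
    refine Finset.sum_bij (fun j _ => g j) (fun j _ => hgS j) ?_ ?_ (fun _ _ => rfl)
    · intro i _ j _ hij
      exact e.injective (by rw [← hge, ← hge, hij])
    · intro p hp
      have : p.1.1 ∈ Set.range e := by
        rw [Finset.range_orderEmbOfFin]
        exact Finset.mem_coe.2 (Finset.mem_image_of_mem (fun p => p.1.1) hp)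
      obtain ⟨j, hj⟩ := this
      exact ⟨j, Finset.mem_univ _, h.injOn_fst_fst _ (hgS j) _ hp (by rw [hge, hj])⟩
  refine ⟨⟨A.card, fun j => (g j).1, fun j => (g j).2, fun j => h.fst_mem _ (hgS j),
    fun j => h.snd_mem _ (hgS j), fun i j hij => (hlt i j hij).1,
    fun i j hij => (hlt i j hij).2⟩, ?_⟩
  simp only [Correspondence.disH, matchingCost]
  rw [hsum fun p => |blockLeb p.1 - blockLeb p.2|, hsum fun p => blockLeb p.1,
    hsum fun p => blockLeb p.2]

theorem Correspondence.disH_nonneg (c : Correspondence β γ) : 0 ≤ c.disH := by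
  obtain ⟨S, hS, h⟩ := c.exists_isMatching
  exact h ▸ hS.cost_nonneg

instance (β γ : IntervalPartition) : Nonempty (Correspondence β γ) :=
  ⟨⟨0, Fin.elim0, Fin.elim0, fun j => j.elim0, fun j => j.elim0, fun j => j.elim0,
    fun j => j.elim0⟩⟩

theorem dH'_nonneg (β γ : IntervalPartition) : 0 ≤ dH' β γ :=
  le_ciInf fun c => c.disH_nonneg

theorem IsMatching.dH'_le (h : IsMatching β γ S) : dH' β γ ≤ matchingCost β γ S := by
  obtain ⟨c, hc⟩ := h.exists_correspondence
  rw [← hc]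
  exact ciInf_le ⟨0, by rintro _ ⟨c, rfl⟩; exact c.disH_nonneg⟩ c

theorem exists_isMatching_cost_lt {ε : ℝ} (h : dH' β γ < ε) :
    ∃ S, IsMatching β γ S ∧ matchingCost β γ S < ε := by
  obtain ⟨c, hc⟩ := exists_lt_of_ciInf_lt h
  obtain ⟨S, hS, h⟩ := c.exists_isMatching
  exact ⟨S, hS, h ▸ hc⟩

/-- The graph of an order-preserving map from finitely many blocks of `β` to blocks of `γ` is a
matching. -/
theorem isMatching_graph {F : Finset (ℝ × ℝ)} {v : ℝ × ℝ → ℝ × ℝ}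
    (hF : ∀ U ∈ F, U ∈ β.blocks) (hv : ∀ U ∈ F, v U ∈ γ.blocks)
    (hord : ∀ U ∈ F, ∀ W ∈ F, U.2 ≤ W.1 → (v U).2 ≤ (v W).1) :
    IsMatching β γ (F.image fun U => (U, v U)) := by
  refine ⟨?_, ?_, ?_⟩
  · rintro p hp
    obtain ⟨U, hU, rfl⟩ := Finset.mem_image.1 hp
    exact hF U hU
  · rintro p hp
    obtain ⟨U, hU, rfl⟩ := Finset.mem_image.1 hp
    exact hv U hU
  · rintro p hp q hq hne
    obtain ⟨U, hU, rfl⟩ := Finset.mem_image.1 hp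
    obtain ⟨W, hW, rfl⟩ := Finset.mem_image.1 hq
    have hUW : U ≠ W := fun e => hne (e ▸ rfl)
    exact (snd_le_fst_or (hF U hU) (hF W hW) hUW).imp
      (fun h => ⟨h, hord U hU W hW h⟩) (fun h => ⟨h, hord W hW U hU h⟩)

theorem sum_graph {F : Finset (ℝ × ℝ)} (v : ℝ × ℝ → ℝ × ℝ) (f : (ℝ × ℝ) × (ℝ × ℝ) → ℝ) :
    ∑ p ∈ F.image (fun U => (U, v U)), f p = ∑ U ∈ F, f (U, v U) :=
  Finset.sum_image fun _ _ _ _ h => congrArg Prod.fst h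

/-- Correspondences are finite, so the identity is available only on finitely many blocks, and the
value 0 may only be approached. -/
theorem dH'_self (β : IntervalPartition) : dH' β β = 0 := by
  refine le_antisymm (le_of_forall_pos_lt_add fun ε hε => ?_) (dH'_nonneg β β)
  obtain ⟨F, hF, hsum⟩ := β.exists_finset_lt_sum hε
  refine (isMatching_graph (v := id) hF hF (fun _ _ _ _ h => h)).dH'_le.trans_lt ?_
  simp only [matchingCost, sum_graph, id, sub_self, abs_zero, Finset.sum_const_zero, max_self]
  linarith

theorem dH'_comm (β γ : IntervalPartition) : dH' β γ = dH' γ β := by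
  have key : ∀ β γ : IntervalPartition, dH' β γ ≤ dH' γ β := fun β γ =>
    le_of_forall_pos_lt_add fun ε hε => by
      obtain ⟨S, hS, h⟩ := exists_isMatching_cost_lt (lt_add_of_pos_right (dH' γ β) hε)
      exact hS.swap.dH'_le.trans_lt (by rwa [matchingCost_swap])
  exact le_antisymm (key β γ) (key γ β)

/-! ### Composition of matchings -/

/-- One of the two inequalities behind the triangle inequality. Here `Q` indexes the pairs
`(p, q) ∈ S × T` for which the blocks `v p` and `v' q` of `γ` agree. -/
theorem sum_abs_sub_sum_comp_le {ι κ l : Type*} {Q : Finset l} {S : Finset ι} {T : Finset κ}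
    {π₁ : l → ι} {π₂ : l → κ} {u : ι → ℝ} {w : κ → ℝ} {v : ι → ℝ × ℝ} {v' : κ → ℝ × ℝ}
    (hv : ∀ p ∈ S, v p ∈ γ.blocks) (hv' : ∀ q ∈ T, v' q ∈ γ.blocks)
    (hvi : Set.InjOn v S) (hvi' : Set.InjOn v' T)
    (h₁ : ∀ x ∈ Q, π₁ x ∈ S) (h₂ : ∀ x ∈ Q, π₂ x ∈ T)
    (hi₁ : Set.InjOn π₁ Q) (hi₂ : Set.InjOn π₂ Q) (hQ : ∀ x ∈ Q, v (π₁ x) = v' (π₂ x))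
    (hQ' : ∀ p ∈ S, ∀ q ∈ T, v p = v' q → ∃ x ∈ Q, π₁ x = p) :
    ∑ x ∈ Q, |u (π₁ x) - w (π₂ x)| - ∑ x ∈ Q, u (π₁ x) ≤
      (∑ p ∈ S, |u p - blockLeb (v p)| - ∑ p ∈ S, u p) +
      (∑ q ∈ T, |blockLeb (v' q) - w q| + γ.mass - ∑ q ∈ T, blockLeb (v' q)) := by
  classical
  have hsub₁ : Q.image π₁ ⊆ S := Finset.image_subset_iff.2 h₁
  have hsub₂ : Q.image π₂ ⊆ T := Finset.image_subset_iff.2 h₂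
  have e₁ : ∀ f : ι → ℝ, ∑ x ∈ Q, f (π₁ x) = ∑ p ∈ S, f p - ∑ p ∈ S \ Q.image π₁, f p := by
    intro f
    rw [← Finset.sum_image (f := f) hi₁, ← Finset.sum_sdiff hsub₁]
    ring
  have e₂ : ∑ x ∈ Q, |blockLeb (v' (π₂ x)) - w (π₂ x)| ≤ ∑ q ∈ T, |blockLeb (v' q) - w q| := by
    rw [← Finset.sum_image (f := fun q => |blockLeb (v' q) - w q|) hi₂]
    exact Finset.sum_le_sum_of_subset_of_nonneg hsub₂ fun _ _ _ => abs_nonneg _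
  have e₃ : ∑ x ∈ Q, |u (π₁ x) - w (π₂ x)| ≤
      ∑ x ∈ Q, |u (π₁ x) - blockLeb (v (π₁ x))| +
        ∑ x ∈ Q, |blockLeb (v' (π₂ x)) - w (π₂ x)| := by
    rw [← Finset.sum_add_distrib]
    refine Finset.sum_le_sum fun x hx => ?_
    rw [hQ x hx]
    exact abs_sub_le _ _ _
  have e₄ : ∑ p ∈ S \ Q.image π₁, u p ≤ ∑ p ∈ S \ Q.image π₁, |u p - blockLeb (v p)| +
      ∑ p ∈ S \ Q.image π₁, blockLeb (v p) := by
    rw [← Finset.sum_add_distrib]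
    exact Finset.sum_le_sum fun p _ => by linarith [le_abs_self (u p - blockLeb (v p))]
  -- A block of `γ` from a dropped pair of `S` is not used by `T`, since otherwise the pair would
  -- have been composed. Together these blocks are distinct blocks of `γ`.
  have e₅ : ∑ p ∈ S \ Q.image π₁, blockLeb (v p) + ∑ q ∈ T, blockLeb (v' q) ≤ γ.mass := by
    rw [← Finset.sum_image (f := blockLeb) (g := v)
        (hvi.mono (Finset.coe_subset.2 Finset.sdiff_subset)),
      ← Finset.sum_image (f := blockLeb) (g := v') hvi', ← Finset.sum_union]
    · refine sum_blockLeb_le_mass fun V hV => ?_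
      rcases Finset.mem_union.1 hV with h | h
      · obtain ⟨p, hp, rfl⟩ := Finset.mem_image.1 h
        exact hv p (Finset.sdiff_subset hp)
      · obtain ⟨q, hq, rfl⟩ := Finset.mem_image.1 h
        exact hv' q hq
    · refine Finset.disjoint_left.2 fun V h h' => ?_
      obtain ⟨p, hp, rfl⟩ := Finset.mem_image.1 h
      obtain ⟨q, hq, hpq⟩ := Finset.mem_image.1 h'
      obtain ⟨hpS, hpQ⟩ := Finset.mem_sdiff.1 hp
      obtain ⟨x, hx, rfl⟩ := hQ' p hpS q hq hpq.symm
      exact hpQ (Finset.mem_image_of_mem _ hx)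
  have e₆ := e₁ fun p => |u p - blockLeb (v p)|
  have e₇ := e₁ u
  linarith

theorem IsMatching.exists_comp (hS : IsMatching β γ S) (hT : IsMatching γ δ T) :
    ∃ R, IsMatching β δ R ∧
      matchingCost β δ R ≤ matchingCost β γ S + matchingCost γ δ T := by
  let Q := (S ×ˢ T).filter fun x => x.1.2 = x.2.1
  have hQ : ∀ x, x ∈ Q ↔ (x.1 ∈ S ∧ x.2 ∈ T) ∧ x.1.2 = x.2.1 := fun x => by
    simp only [Q, Finset.mem_filter, Finset.mem_product]
  have hi₁ : Set.InjOn Prod.fst (Q : Set (((ℝ × ℝ) × (ℝ × ℝ)) × ((ℝ × ℝ) × (ℝ × ℝ)))) := by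
    intro x hx y hy hxy
    have hx := (hQ x).1 hx
    have hy := (hQ y).1 hy
    exact Prod.ext hxy (hT.injOn_fst _ hx.1.2 _ hy.1.2 (by rw [← hx.2, ← hy.2, hxy]))
  have hi₂ : Set.InjOn Prod.snd (Q : Set (((ℝ × ℝ) × (ℝ × ℝ)) × ((ℝ × ℝ) × (ℝ × ℝ)))) := by
    intro x hx y hy hxy
    have hx := (hQ x).1 hx
    have hy := (hQ y).1 hy
    exact Prod.ext (hS.injOn_snd _ hx.1.1 _ hy.1.1 (by rw [hx.2, hy.2, hxy])) hxy
  have hinj : Set.InjOn (fun x => (x.1.1, x.2.2))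
      (Q : Set (((ℝ × ℝ) × (ℝ × ℝ)) × ((ℝ × ℝ) × (ℝ × ℝ)))) := by
    intro x hx y hy hxy
    refine hi₁ hx hy (hS.injOn_fst _ ((hQ x).1 hx).1.1 _ ((hQ y).1 hy).1.1 ?_)
    exact (Prod.ext_iff.1 hxy).1
  refine ⟨Q.image fun x => (x.1.1, x.2.2), ⟨?_, ?_, ?_⟩, ?_⟩
  · rintro p hp
    obtain ⟨x, hx, rfl⟩ := Finset.mem_image.1 hp
    exact hS.fst_mem x.1 ((hQ x).1 hx).1.1
  · rintro p hp
    obtain ⟨x, hx, rfl⟩ := Finset.mem_image.1 hp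
    exact hT.snd_mem x.2 ((hQ x).1 hx).1.2
  · rintro p hp q hq hne
    obtain ⟨x, hx', rfl⟩ := Finset.mem_image.1 hp
    obtain ⟨y, hy', rfl⟩ := Finset.mem_image.1 hq
    have hx := (hQ x).1 hx'
    have hy := (hQ y).1 hy'
    have hxy : x ≠ y := fun e => hne (e ▸ rfl)
    have h1 := hS.ordered _ hx.1.1 _ hy.1.1 (fun e => hxy (hi₁ hx' hy' e))
    have h2 := hT.ordered _ hx.1.2 _ hy.1.2 (fun e => hxy (hi₂ hx' hy' e))
    rw [← hx.2, ← hy.2] at h2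
    have l1 := γ.lt_of_mem _ (hS.snd_mem _ hx.1.1)
    have l2 := γ.lt_of_mem _ (hS.snd_mem _ hy.1.1)
    -- The mixed cases would put the two middle blocks in both orders.
    rcases h1 with h1 | h1 <;> rcases h2 with h2 | h2
    · exact .inl ⟨h1.1, h2.2⟩
    · linarith [h1.2, h2.1]
    · linarith [h1.2, h2.1]
    · exact .inr ⟨h1.1, h2.2⟩
  · simp only [matchingCost, Finset.sum_image hinj]
    have k1 := sum_abs_sub_sum_comp_le (γ := γ) (Q := Q) (S := S) (T := T) (π₁ := Prod.fst)
      (π₂ := Prod.snd) (u := fun p => blockLeb p.1) (w := fun q => blockLeb q.2)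
      (v := Prod.snd) (v' := Prod.fst) hS.snd_mem hT.fst_mem hS.injOn_snd hT.injOn_fst
      (fun x hx => ((hQ x).1 hx).1.1) (fun x hx => ((hQ x).1 hx).1.2) hi₁ hi₂
      (fun x hx => ((hQ x).1 hx).2)
      (fun p hp q hq hpq => ⟨(p, q), (hQ _).2 ⟨⟨hp, hq⟩, hpq⟩, rfl⟩)
    -- The same estimate read from `δ` to `β` controls the other entry of the maximum.
    have k2 := sum_abs_sub_sum_comp_le (γ := γ) (Q := Q) (S := T) (T := S) (π₁ := Prod.snd)
      (π₂ := Prod.fst) (u := fun q => blockLeb q.2) (w := fun p => blockLeb p.1)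
      (v := Prod.fst) (v' := Prod.snd) hT.fst_mem hS.snd_mem hT.injOn_fst hS.injOn_snd
      (fun x hx => ((hQ x).1 hx).1.2) (fun x hx => ((hQ x).1 hx).1.1) hi₂ hi₁
      (fun x hx => ((hQ x).1 hx).2.symm)
      (fun q hq p hp hpq => ⟨(p, q), (hQ _).2 ⟨⟨hp, hq⟩, hpq.symm⟩, rfl⟩)
    have s1 : ∑ x ∈ Q, |blockLeb x.2.2 - blockLeb x.1.1| =
        ∑ x ∈ Q, |blockLeb x.1.1 - blockLeb x.2.2| :=
      Finset.sum_congr rfl fun _ _ => abs_sub_comm _ _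
    have s2 : ∑ q ∈ T, |blockLeb q.2 - blockLeb q.1| = ∑ q ∈ T, |blockLeb q.1 - blockLeb q.2| :=
      Finset.sum_congr rfl fun _ _ => abs_sub_comm _ _
    have s3 : ∑ q ∈ S, |blockLeb q.2 - blockLeb q.1| = ∑ q ∈ S, |blockLeb q.1 - blockLeb q.2| :=
      Finset.sum_congr rfl fun _ _ => abs_sub_comm _ _
    rw [s1, s2, s3] at k2
    refine max_le ?_ ?_
    · refine le_trans ?_ (add_le_add (le_max_left _ _) (le_max_left _ _))
      linarith
    · refine le_trans ?_ (add_le_add (le_max_right _ _) (le_max_right _ _))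
      linarith

theorem dH'_triangle (β γ δ : IntervalPartition) : dH' β δ ≤ dH' β γ + dH' γ δ := by
  refine le_of_forall_pos_lt_add fun ε hε => ?_
  obtain ⟨S, hS, h1⟩ := exists_isMatching_cost_lt (lt_add_of_pos_right (dH' β γ) (half_pos hε))
  obtain ⟨T, hT, h2⟩ := exists_isMatching_cost_lt (lt_add_of_pos_right (dH' γ δ) (half_pos hε))
  obtain ⟨R, hR, h3⟩ := hS.exists_comp hT
  linarith [hR.dH'_le]

/-! ### Comparison of the two distances -/

/-- Every point of `β.compl` is within the distortion of a point of `γ.compl`. -/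
theorem IsMatching.exists_dist_le (h : IsMatching β γ S) {t : ℝ} (ht : t ∈ β.compl) :
    ∃ s ∈ γ.compl, dist t s ≤ matchingCost β γ S := by
  classical
  obtain ⟨⟨ht0, htm⟩, -⟩ := mem_compl_iff.1 ht
  let L := S.filter fun p => p.1.2 ≤ t
  let R := S.filter fun p => ¬ p.1.2 ≤ t
  have hL : ∀ p, p ∈ L ↔ p ∈ S ∧ p.1.2 ≤ t := fun p => Finset.mem_filter
  have hR : ∀ p, p ∈ R ↔ p ∈ S ∧ ¬ p.1.2 ≤ t := fun p => Finset.mem_filter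
  have hLS : L ⊆ S := Finset.filter_subset _ _
  have hRS : R ⊆ S := Finset.filter_subset _ _
  -- The point `s` is the right end of the last block of `γ` matched to the left of `t`, or 0 if
  -- there is none.
  have hs : ∃ s ∈ γ.compl, (∀ p ∈ L, p.2.2 ≤ s) ∧ ∀ p ∈ R, s ≤ p.2.1 := by
    rcases L.eq_empty_or_nonempty with he | hne
    · refine ⟨0, γ.zero_mem_compl, by simp [he], fun p hp => ?_⟩
      exact fst_nonneg (h.snd_mem p (hRS hp))
    · obtain ⟨q, hq, hmax⟩ := L.exists_max_image (fun p => p.2.2) hne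
      refine ⟨q.2.2, snd_mem_compl (h.snd_mem q (hLS hq)), hmax, fun p hp => ?_⟩
      have hp' := (hR p).1 hp
      have hq' := (hL q).1 hq
      have hne : q ≠ p := fun e => hp'.2 (e ▸ hq'.2)
      refine ((h.ordered q hq'.1 p hp'.1 hne).resolve_right fun h' => hp'.2 ?_).2
      linarith [h'.1, β.lt_of_mem _ (h.fst_mem q hq'.1)]
  obtain ⟨s, hsC, hsL, hsR⟩ := hs
  obtain ⟨⟨hs0, hsm⟩, -⟩ := mem_compl_iff.1 hsC
  refine ⟨s, hsC, ?_⟩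
  have a1 := (h.mono hLS).sum_fst_le ht0 (fun p hp => fst_nonneg (h.fst_mem p (hLS hp)))
    (fun p hp => ((hL p).1 hp).2)
  have a2 := (h.mono hRS).sum_fst_le htm
    (fun p hp => (le_fst_or_snd_le (h.fst_mem p (hRS hp)) ht).resolve_right ((hR p).1 hp).2)
    (fun p hp => snd_le_mass (h.fst_mem p (hRS hp)))
  have b1 := (h.mono hLS).sum_snd_le hs0 (fun p hp => fst_nonneg (h.snd_mem p (hLS hp))) hsL
  have b2 := (h.mono hRS).sum_snd_le hsm hsR
    (fun p hp => snd_le_mass (h.snd_mem p (hRS hp)))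
  have split : ∀ f : (ℝ × ℝ) × (ℝ × ℝ) → ℝ, ∑ p ∈ L, f p + ∑ p ∈ R, f p = ∑ p ∈ S, f p :=
    fun f => Finset.sum_filter_add_sum_filter_not S _ f
  have c1 := split fun p => blockLeb p.1
  have c2 := split fun p => blockLeb p.2
  -- The masses matched to the left of `t` and of `s` differ by at most the total discrepancy;
  -- unmatched mass accounts for the rest of `|t - s|`.
  have c3 : |∑ p ∈ L, blockLeb p.1 - ∑ p ∈ L, blockLeb p.2| ≤
      ∑ p ∈ S, |blockLeb p.1 - blockLeb p.2| := by
    rw [← Finset.sum_sub_distrib]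
    exact (Finset.abs_sum_le_sum_abs _ _).trans
      (Finset.sum_le_sum_of_subset_of_nonneg hLS fun _ _ _ => abs_nonneg _)
  have c4 := abs_le.1 c3
  rw [Real.dist_eq, abs_le]
  have m1 := le_max_left (∑ p ∈ S, |blockLeb p.1 - blockLeb p.2| + β.mass - ∑ p ∈ S, blockLeb p.1)
    (∑ p ∈ S, |blockLeb p.1 - blockLeb p.2| + γ.mass - ∑ p ∈ S, blockLeb p.2)
  have m2 := le_max_right
    (∑ p ∈ S, |blockLeb p.1 - blockLeb p.2| + β.mass - ∑ p ∈ S, blockLeb p.1)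
    (∑ p ∈ S, |blockLeb p.1 - blockLeb p.2| + γ.mass - ∑ p ∈ S, blockLeb p.2)
  rw [matchingCost]
  constructor <;> linarith [c4.1, c4.2]

theorem dH_le_dH' (β γ : IntervalPartition) : dH β γ ≤ dH' β γ := by
  refine le_of_forall_pos_lt_add fun ε hε => ?_
  obtain ⟨S, hS, h⟩ := exists_isMatching_cost_lt (lt_add_of_pos_right (dH' β γ) hε)
  refine (Metric.hausdorffDist_le_of_mem_dist hS.cost_nonneg (fun t ht => hS.exists_dist_le ht)
    fun t ht => ?_).trans_lt h
  rw [← matchingCost_swap]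
  exact hS.swap.exists_dist_le ht

theorem isMetric_dH' : IsMetric dH' where
  nonneg := dH'_nonneg
  self := dH'_self
  eq_of_zero β γ h :=
    isMetric_dH.eq_of_zero β γ (le_antisymm (h ▸ dH_le_dH' β γ) (isMetric_dH.nonneg β γ))
  symm := dH'_comm
  triangle := dH'_triangle

end IntervalPartition

theorem IsMetric.topology_le {X : Type*} {d d' : X → X → ℝ} (h : IsMetric d) (h' : IsMetric d')
    (H : ∀ x, ∀ ε > 0, ∃ r > 0, ∀ y, d x y < r → d' x y < ε) : h.topology ≤ h'.topology := by
  rw [← continuous_id_iff_le]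
  refine (@Metric.continuous_iff X X h.toMetricSpace.toPseudoMetricSpace
    h'.toMetricSpace.toPseudoMetricSpace id).2 fun x ε hε => ?_
  obtain ⟨r, hr, H⟩ := H x ε hε
  refine ⟨r, hr, fun y hy => ?_⟩
  change d' y x < ε
  rw [h'.symm]
  exact H y (by rw [h.symm]; exact hy)

namespace IntervalPartition

variable {β γ : IntervalPartition} {U V : ℝ × ℝ} {r : ℝ}

/-! ### Blocks of partitions that are close in the Hausdorff distance -/

theorem dH_comm (β γ : IntervalPartition) : dH β γ = dH γ β := isMetric_dH.symm β γ

theorem exists_near (h : dH β γ < r) {x : ℝ} (hx : x ∈ β.compl) : ∃ y ∈ γ.compl, |x - y| < r :=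
  Metric.exists_dist_lt_of_hausdorffDist_lt hx h
    (Metric.hausdorffEDist_ne_top_of_nonempty_of_bounded ⟨0, β.zero_mem_compl⟩
      ⟨0, γ.zero_mem_compl⟩ β.isCompact_compl.isBounded γ.isCompact_compl.isBounded)

theorem mass_lt_of_dH_lt (h : dH β γ < r) : β.mass < γ.mass + r := by
  obtain ⟨y, hy, hlt⟩ := exists_near h β.mass_mem_compl
  linarith [(abs_lt.1 hlt).2, (mem_compl_iff.1 hy).1.2]

/-- A block of `β` of length more than `2 r` is within `r` of a block of any `γ` that is within
`r` of `β`. -/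
theorem exists_near_block (h : dH β γ < r) (hU : U ∈ β.blocks) (hr : 2 * r < U.2 - U.1) :
    ∃ V ∈ γ.blocks, |V.1 - U.1| < r ∧ |V.2 - U.2| < r := by
  have h' : dH γ β < r := by rwa [dH_comm]
  obtain ⟨y₁, hy₁, hd₁⟩ := exists_near h (fst_mem_compl hU)
  obtain ⟨y₂, hy₂, hd₂⟩ := exists_near h (snd_mem_compl hU)
  rw [abs_lt] at hd₁ hd₂
  -- The midpoint is more than `r` from both ends of `U`, hence from all of `β.compl`, so it lies in
  -- a block of `γ`.
  have hm : (U.1 + U.2) / 2 ∉ γ.compl := fun hm => by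
    obtain ⟨x, hx, hd⟩ := exists_near h' hm
    rw [abs_lt] at hd
    rcases le_fst_or_snd_le hU hx with h | h <;> linarith
  have hy₂m := (mem_compl_iff.1 hy₂).1.2
  obtain ⟨V, hV, hV1, hV2⟩ := exists_block_of_notMem_compl
    (by linarith [fst_nonneg hU, β.lt_of_mem U hU]) (by linarith) hm
  obtain ⟨x₁, hx₁, he₁⟩ := exists_near h' (fst_mem_compl hV)
  obtain ⟨x₂, hx₂, he₂⟩ := exists_near h' (snd_mem_compl hV)
  rw [abs_lt] at he₁ he₂
  refine ⟨V, hV, abs_lt.2 ⟨?_, ?_⟩, abs_lt.2 ⟨?_, ?_⟩⟩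
  · rcases le_fst_or_snd_le hV hy₁ with h | h <;> linarith
  · rcases le_fst_or_snd_le hU hx₁ with h | h <;> linarith
  · rcases le_fst_or_snd_le hU hx₂ with h | h <;> linarith
  · rcases le_fst_or_snd_le hV hy₂ with h | h <;> linarith

/-- Finitely many blocks of `β` persist, in the same order, in all partitions close to `β`. -/
theorem exists_near_blocks {F : Finset (ℝ × ℝ)} (hF : ∀ U ∈ F, U ∈ β.blocks) :
    ∃ r₀ > 0, ∀ r ≤ r₀, ∀ γ, dH β γ < r → ∃ v : ℝ × ℝ → ℝ × ℝ,
      (∀ U ∈ F, v U ∈ γ.blocks ∧ |(v U).1 - U.1| < r ∧ |(v U).2 - U.2| < r) ∧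
      ∀ U ∈ F, ∀ W ∈ F, U.2 ≤ W.1 → (v U).2 ≤ (v W).1 := by
  -- The factor 4 leaves room both for the persistence of each block and for the order of the
  -- perturbed blocks.
  obtain ⟨r₀, hr₀, hmin⟩ : ∃ r₀ > 0, ∀ U ∈ F, 4 * r₀ ≤ U.2 - U.1 := by
    rcases F.eq_empty_or_nonempty with rfl | hne
    · exact ⟨1, one_pos, by simp⟩
    · obtain ⟨W, hW, hmin⟩ := F.exists_min_image (fun U => U.2 - U.1) hne
      have := β.lt_of_mem W (hF W hW)
      exact ⟨(W.2 - W.1) / 4, by linarith, fun U hU => by linarith [hmin U hU]⟩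
  refine ⟨r₀, hr₀, fun r hr γ hγ => ?_⟩
  have hrpos : 0 < r := (isMetric_dH.nonneg β γ).trans_lt hγ
  have hex : ∀ U, ∃ V, U ∈ F → V ∈ γ.blocks ∧ |V.1 - U.1| < r ∧ |V.2 - U.2| < r := fun U => by
    by_cases hU : U ∈ F
    · obtain ⟨V, h⟩ := exists_near_block hγ (hF U hU) (by linarith [hmin U hU])
      exact ⟨V, fun _ => h⟩
    · exact ⟨0, fun h => absurd h hU⟩
  choose v hv using hex
  refine ⟨v, hv, fun U hU W hW hUW => ?_⟩
  obtain ⟨h1, -, h2⟩ := hv U hU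
  obtain ⟨h3, -, h4⟩ := hv W hW
  rw [abs_lt] at h2 h4
  have hlt : (v U).2 < (v W).2 := by linarith [hmin W hW]
  refine (snd_le_fst_or h1 h3 fun e => hlt.ne (e ▸ rfl)).resolve_right fun h => ?_
  linarith [γ.lt_of_mem _ h1]

/-- Matching `k` persistent blocks, each changed in length by at most `2 * r`, costs less than `ε /
2 + 4 * k * r + r`. The radius depends on `β` through `k`, so only the topologies are compared, not
the Cauchy sequences. -/
theorem exists_dH'_lt_of_dH_lt (β : IntervalPartition) {ε : ℝ} (hε : 0 < ε) :
    ∃ r > 0, ∀ γ, dH β γ < r → dH' β γ < ε := by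
  obtain ⟨F, hF, hsum⟩ := β.exists_finset_lt_sum (half_pos hε)
  obtain ⟨r₀, hr₀, H⟩ := exists_near_blocks hF
  let k : ℝ := F.card
  have hk : 0 ≤ k := Nat.cast_nonneg _
  let r := min r₀ (ε / (8 * (k + 1)))
  have hr : 0 < r := lt_min hr₀ (by positivity)
  have hrk : 8 * (k + 1) * r ≤ ε := by
    have : r ≤ ε / (8 * (k + 1)) := min_le_right _ _
    rw [le_div_iff₀ (by positivity)] at this
    linarith
  refine ⟨r, hr, fun γ hγ => ?_⟩
  obtain ⟨v, hv, hord⟩ := H r (min_le_left _ _) γ hγ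
  refine (isMatching_graph hF (fun U hU => (hv U hU).1) hord).dH'_le.trans_lt ?_
  have habs : ∀ U ∈ F, |blockLeb U - blockLeb (v U)| ≤ 2 * r := fun U hU => by
    obtain ⟨-, h1, h2⟩ := hv U hU
    rw [abs_lt] at h1 h2
    rw [blockLeb, blockLeb, abs_le]
    constructor <;> linarith
  have hs1 : ∑ U ∈ F, |blockLeb U - blockLeb (v U)| ≤ k * (2 * r) := by
    simpa [k] using Finset.sum_le_card_nsmul F _ _ habs
  have hs2 : ∑ U ∈ F, blockLeb U - ∑ U ∈ F, blockLeb (v U) ≤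
      ∑ U ∈ F, |blockLeb U - blockLeb (v U)| := by
    rw [← Finset.sum_sub_distrib]
    exact Finset.sum_le_sum fun U _ => le_abs_self _
  have hm : γ.mass < β.mass + r := mass_lt_of_dH_lt (by rwa [dH_comm])
  have hkr : 0 ≤ k * r := by positivity
  simp only [matchingCost, sum_graph]
  refine max_lt ?_ ?_ <;> linarith

/-! ### Equality of the topologies and separability -/

theorem topology_dH_eq : isMetric_dH.topology = isMetric_dH'.topology := by
  refine le_antisymm (isMetric_dH.topology_le isMetric_dH' fun β ε hε =>
    β.exists_dH'_lt_of_dH_lt hε) (isMetric_dH'.topology_le isMetric_dH fun β ε hε =>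
    ⟨ε, hε, fun γ h => (dH_le_dH' β γ).trans_lt h⟩)

theorem isometry_complNonemptyCompacts :
    @Isometry _ _ isMetric_dH.toMetricSpace.toPseudoMetricSpace.toPseudoEMetricSpace _
      complNonemptyCompacts := by
  let _ := isMetric_dH.toMetricSpace
  exact Isometry.of_dist_eq fun β γ => dist_complNonemptyCompacts β γ

theorem secondCountableTopology_dH :
    @SecondCountableTopology IntervalPartition isMetric_dH.topology := by
  let _ := isMetric_dH.toMetricSpace
  exact isometry_complNonemptyCompacts.isEmbedding.secondCountableTopology

theorem separableSpace_dH' :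
    @TopologicalSpace.SeparableSpace IntervalPartition isMetric_dH'.topology := by
  rw [← topology_dH_eq]
  let _ := isMetric_dH.toMetricSpace
  have := secondCountableTopology_dH
  infer_instance

/-! ### Completeness -/

/-- If `β` and `γ` are close in `dH'`, then few blocks of `γ`, namely at most as many as in a
given large finite set of blocks of `β`, carry almost all the mass of `γ`. -/
theorem exists_finset_of_dH'_lt {F : Finset (ℝ × ℝ)} {ε : ℝ} (hF : ∀ U ∈ F, U ∈ β.blocks)
    (hsum : β.mass - ε < ∑ U ∈ F, blockLeb U) (h : dH' β γ < ε) :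
    ∃ G : Finset (ℝ × ℝ), (∀ V ∈ G, V ∈ γ.blocks) ∧ G.card ≤ F.card ∧
      γ.mass - 2 * ε < ∑ V ∈ G, blockLeb V := by
  classical
  obtain ⟨S, hS, hc⟩ := exists_isMatching_cost_lt h
  let A := S.filter fun p => p.1 ∈ F
  let B := S.filter fun p => p.1 ∉ F
  have hAS : A ⊆ S := Finset.filter_subset _ _
  have hBS : B ⊆ S := Finset.filter_subset _ _
  have hA := hS.mono hAS
  have hB := hS.mono hBS
  refine ⟨A.image Prod.snd, fun V hV => ?_, ?_, ?_⟩
  · obtain ⟨p, hp, rfl⟩ := Finset.mem_image.1 hV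
    exact hA.snd_mem p hp
  · refine Finset.card_image_le.trans (Finset.card_le_card_of_injOn Prod.fst ?_ hA.injOn_fst)
    exact fun p hp => (Finset.mem_filter.1 hp).2
  · rw [Finset.sum_image hA.injOn_snd]
    have h1 : ∑ p ∈ B, blockLeb p.1 + ∑ U ∈ F, blockLeb U ≤ β.mass := by
      rw [← Finset.sum_image (f := blockLeb) (g := Prod.fst) hB.injOn_fst, ← Finset.sum_union]
      · refine sum_blockLeb_le_mass fun U hU => ?_
        rcases Finset.mem_union.1 hU with h | h
        · obtain ⟨p, hp, rfl⟩ := Finset.mem_image.1 h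
          exact hB.fst_mem p hp
        · exact hF U h
      · refine Finset.disjoint_left.2 fun U h h' => ?_
        obtain ⟨p, hp, rfl⟩ := Finset.mem_image.1 h
        exact (Finset.mem_filter.1 hp).2 h'
    have h2 : ∑ p ∈ B, blockLeb p.2 ≤ ∑ p ∈ B, blockLeb p.1 +
        ∑ p ∈ S, |blockLeb p.1 - blockLeb p.2| := by
      refine le_trans ?_ (add_le_add_right (Finset.sum_le_sum_of_subset_of_nonneg hBS
        fun _ _ _ => abs_nonneg _) _)
      rw [← Finset.sum_add_distrib]
      exact Finset.sum_le_sum fun p _ => by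
        linarith [neg_abs_le (blockLeb p.1 - blockLeb p.2)]
    have h3 : ∑ p ∈ A, blockLeb p.2 + ∑ p ∈ B, blockLeb p.2 = ∑ p ∈ S, blockLeb p.2 :=
      Finset.sum_filter_add_sum_filter_not S _ _
    -- The discrepancy allowed in `h2` cancels against the one counted in `h4`, which leaves `2 *
    -- ε`.
    have h4 := (le_max_right _ _).trans_lt hc
    linarith

/-- A bound on the measure of a compact set close to the complement of `γ`, in terms of finitely
many blocks of `γ`. -/
theorem volume_le_of_dist_lt {K : TopologicalSpace.NonemptyCompacts ℝ}
    (hK : dist γ.complNonemptyCompacts K < r) {G : Finset (ℝ × ℝ)}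
    (hG : ∀ V ∈ G, V ∈ γ.blocks) (hnn : (K : Set ℝ) ⊆ Set.Ici 0) {η : ℝ} (hη : 0 ≤ η)
    (hsum : γ.mass - η ≤ ∑ V ∈ G, blockLeb V) :
    volume (K : Set ℝ) ≤ ENNReal.ofReal (η + (2 * G.card + 1) * r) := by
  have hr : 0 < r := dist_nonneg.trans_lt hK
  have hnear : ∀ x ∈ (K : Set ℝ), ∃ y ∈ γ.compl, |x - y| < r := fun x hx =>
    Metric.exists_dist_lt_of_hausdorffDist_lt hx (by rwa [dist_comm] at hK)
      (Metric.hausdorffEDist_ne_top_of_nonempty_of_bounded K.nonempty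
        ⟨0, γ.zero_mem_compl⟩ K.isCompact.isBounded γ.isCompact_compl.isBounded)
  -- Blocks shrunk by `r` at both ends miss `K`; the maximum makes those that are too short empty.
  let W : ℝ × ℝ → ℝ × ℝ := fun V => (V.1 + r, max (V.1 + r) (V.2 - r))
  have hWsub : ∀ V, Set.Ioo (W V).1 (W V).2 ⊆ Set.Ioo (V.1 + r) (V.2 - r) := by
    rintro V x ⟨h1, h2⟩
    exact ⟨h1, (lt_max_iff.1 h2).resolve_left h1.not_gt⟩
  have hWsub' : ∀ V, Set.Ioo (W V).1 (W V).2 ⊆ Set.Ioo V.1 V.2 := fun V =>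
    (hWsub V).trans (Set.Ioo_subset_Ioo (by linarith) (by linarith))
  have key := volume_add_sum_blockLeb_le (s := 0) (t := γ.mass + r) (C := (K : Set ℝ)) (F := G)
    (W := W) ?_ (fun V _ => le_max_left _ _) ?_ ?_ ?_
  · have hs : γ.mass - η - 2 * G.card * r ≤ ∑ V ∈ G, blockLeb (W V) := by
      have h1 : ∑ V ∈ G, (blockLeb V - 2 * r) ≤ ∑ V ∈ G, blockLeb (W V) :=
        Finset.sum_le_sum fun V _ => by
          simp only [blockLeb, W]
          linarith [le_max_right (V.1 + r) (V.2 - r)]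
      rw [Finset.sum_sub_distrib, Finset.sum_const, nsmul_eq_mul] at h1
      linarith
    have hle : ENNReal.ofReal (γ.mass + r - 0) ≤ ENNReal.ofReal (η + (2 * G.card + 1) * r) +
        ENNReal.ofReal (∑ V ∈ G, blockLeb (W V)) := by
      have hWnn : 0 ≤ ∑ V ∈ G, blockLeb (W V) :=
        Finset.sum_nonneg fun V _ => sub_nonneg.2 (le_max_left _ _)
      rw [← ENNReal.ofReal_add (by positivity) hWnn]
      exact ENNReal.ofReal_le_ofReal (by linarith)
    exact (ENNReal.add_le_add_iff_right ENNReal.ofReal_ne_top).1 (key.trans hle)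
  · intro x hx
    obtain ⟨y, hy, hxy⟩ := hnear x hx
    exact ⟨hnn hx, by linarith [(abs_lt.1 hxy).2, (mem_compl_iff.1 hy).1.2]⟩
  · intro V hV V' hV' hne
    exact (γ.pairwiseDisjoint (hG V hV) (hG V' hV') hne).mono (hWsub' V) (hWsub' V')
  · refine fun V hV => Set.disjoint_left.2 fun x hx hxV => ?_
    obtain ⟨y, hy, hxy⟩ := hnear x hx
    have := hWsub V hxV
    rw [abs_lt] at hxy
    rcases le_fst_or_snd_le (hG V hV) hy with h | h <;> linarith [this.1, this.2]
  · exact fun V hV => (hWsub' V).trans ((γ.subset_of_mem V (hG V hV)).trans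
      (Set.Icc_subset_Icc_right (by linarith)))

theorem isComplete_dH' : isMetric_dH'.IsComplete := by
  let _ := isMetric_dH'.toMetricSpace
  refine Metric.complete_of_cauchySeq_tendsto fun u hu => ?_
  rw [Metric.cauchySeq_iff] at hu
  have hu : ∀ ε > 0, ∃ N, ∀ m ≥ N, ∀ n ≥ N, dH' (u m) (u n) < ε := hu
  have hcauchy : CauchySeq fun n => (u n).complNonemptyCompacts :=
    Metric.cauchySeq_iff.2 fun ε hε => by
      obtain ⟨N, hN⟩ := hu ε hε
      exact ⟨N, fun m hm n hn => (dH_le_dH' _ _).trans_lt (hN m hm n hn)⟩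
  obtain ⟨K, hK⟩ := cauchySeq_tendsto_of_complete hcauchy
  rw [Metric.tendsto_atTop] at hK
  have hne : ∀ n, Metric.hausdorffEDist (u n).compl (K : Set ℝ) ≠ ⊤ := fun n =>
    Metric.hausdorffEDist_ne_top_of_nonempty_of_bounded ⟨0, (u n).zero_mem_compl⟩ K.nonempty
      (u n).isCompact_compl.isBounded K.isCompact.isBounded
  have h0 : (0 : ℝ) ∈ (K : Set ℝ) := by
    refine K.isCompact.isClosed.closure_subset (Metric.mem_closure_iff.2 fun ε hε => ?_)
    obtain ⟨N, hN⟩ := hK ε hε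
    exact Metric.exists_dist_lt_of_hausdorffDist_lt (u N).zero_mem_compl (hN N le_rfl) (hne N)
  have hnn : (K : Set ℝ) ⊆ Set.Ici 0 := by
    refine fun x hx => Set.mem_Ici.2 <| le_of_forall_pos_lt_add fun ε hε => ?_
    obtain ⟨N, hN⟩ := hK ε hε
    obtain ⟨y, hy, hxy⟩ := Metric.exists_dist_lt_of_hausdorffDist_lt' hx (hN N le_rfl) (hne N)
    linarith [(abs_lt.1 hxy).2, (mem_compl_iff.1 hy).1.1]
  have hvol : volume (K : Set ℝ) = 0 := by
    refine le_antisymm (ENNReal.le_of_forall_pos_le_add fun ε hε _ => ?_) zero_le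
    rw [zero_add, ← ENNReal.ofReal_coe_nnreal]
    have hε' : (0 : ℝ) < ε / 4 := by positivity
    -- `N` and `F` are fixed before the Hausdorff radius, so the number of blocks needed in later
    -- terms is bounded by `F.card` and the radius can be chosen against it.
    obtain ⟨N, hN⟩ := hu (ε / 4) hε'
    obtain ⟨F, hF, hsum⟩ := (u N).exists_finset_lt_sum hε'
    have hk : (0 : ℝ) < 2 * F.card + 1 := by positivity
    obtain ⟨M, hM⟩ := hK (ε / 2 / (2 * F.card + 1)) (by positivity)
    obtain ⟨G, hG, hcard, hGsum⟩ :=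
      exists_finset_of_dH'_lt hF hsum (hN N le_rfl (max N M) (le_max_left _ _))
    refine (volume_le_of_dist_lt (hM (max N M) (le_max_right _ _)) hG hnn
      (by positivity) hGsum.le).trans (ENNReal.ofReal_le_ofReal ?_)
    have h1 : (2 * (G.card : ℝ) + 1) * (ε / 2 / (2 * F.card + 1)) ≤ ε / 2 := by
      rw [mul_div_assoc', div_le_iff₀ hk, mul_comm]
      have : (G.card : ℝ) ≤ F.card := Nat.cast_le.2 hcard
      gcongr
    linarith
  let β := ofCompact K K.isCompact h0 hnn hvol
  have hβ : β.complNonemptyCompacts = K :=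
    TopologicalSpace.NonemptyCompacts.ext (compl_ofCompact K.isCompact h0 hnn hvol)
  refine ⟨β, Metric.tendsto_atTop.2 fun ε hε => ?_⟩
  -- Once the Hausdorff limit is known to be an interval partition, convergence in `dH` gives
  -- convergence in `dH'`.
  obtain ⟨r, hr, H⟩ := β.exists_dH'_lt_of_dH_lt hε
  obtain ⟨N, hN⟩ := hK r hr
  refine ⟨N, fun n hn => ?_⟩
  change dH' (u n) β < ε
  rw [dH'_comm]
  refine H _ ?_
  rw [← dist_complNonemptyCompacts, hβ, dist_comm]
  exact hN n hn

/-- The interval partition with a given finite complement. -/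
noncomputable def ofFinite (C : Set ℝ) (hC : C.Finite) (h0 : 0 ∈ C) (hnn : C ⊆ Set.Ici 0) :
    IntervalPartition :=
  ofCompact C hC.isCompact h0 hnn (hC.measure_zero volume)

theorem compl_ofFinite {C : Set ℝ} (hC : C.Finite) (h0 : 0 ∈ C) (hnn : C ⊆ Set.Ici 0) :
    (ofFinite C hC h0 hnn).compl = C :=
  compl_ofCompact _ _ _ _

theorem not_isComplete_dH : ¬ isMetric_dH.IsComplete := by
  intro hcomplete
  let _ := isMetric_dH.toMetricSpace
  have : CompleteSpace IntervalPartition := hcomplete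
  -- Grids of mesh `1 / (n + 1)` converge to `[0, 1]`, which is not null and so is no complement.
  let C : ℕ → Set ℝ := fun n => (fun k : ℕ => (k : ℝ) / (n + 1)) '' Set.Iic (n + 1)
  have hC : ∀ n, (C n).Finite := fun n => (Set.finite_Iic _).image _
  have h0 : ∀ n, 0 ∈ C n := fun n => ⟨0, Nat.zero_le _, by simp⟩
  have hnn : ∀ n, C n ⊆ Set.Ici 0 := by
    rintro n _ ⟨k, -, rfl⟩
    exact Set.mem_Ici.2 (by positivity)
  let u : ℕ → IntervalPartition := fun n => ofFinite (C n) (hC n) (h0 n) (hnn n)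
  let I : TopologicalSpace.NonemptyCompacts ℝ := ⟨⟨Set.Icc 0 1, isCompact_Icc⟩, ⟨0, by simp⟩⟩
  have hdist : ∀ n, dist (u n).complNonemptyCompacts I ≤ 1 / (n + 1) := by
    intro n
    change Metric.hausdorffDist (u n).compl (Set.Icc 0 1) ≤ _
    rw [compl_ofFinite]
    have hn : (0 : ℝ) < n + 1 := by positivity
    refine Metric.hausdorffDist_le_of_mem_dist (by positivity) ?_ ?_
    · rintro _ ⟨k, hk, rfl⟩
      refine ⟨(k : ℝ) / (n + 1), ⟨by positivity, ?_⟩, by simp; positivity⟩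
      rw [div_le_one hn]
      exact_mod_cast hk
    · rintro x ⟨hx0, hx1⟩
      have hx : 0 ≤ x * (n + 1) := by positivity
      refine ⟨(⌊x * (n + 1)⌋₊ : ℝ) / (n + 1), ⟨_, ?_, rfl⟩, ?_⟩
      · refine Nat.floor_le_of_le ?_
        push_cast
        nlinarith
      · have h1 := Nat.floor_le hx
        have h2 := Nat.lt_floor_add_one (x * (n + 1))
        have h3 : x - (⌊x * (n + 1)⌋₊ : ℝ) / (n + 1) =
            (x * (n + 1) - ⌊x * (n + 1)⌋₊) / (n + 1) := by field_simp
        rw [Real.dist_eq, h3, abs_div, abs_of_pos hn, abs_of_nonneg (by linarith)]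
        gcongr
        linarith
  have hlim : Tendsto (fun n => (u n).complNonemptyCompacts) atTop (𝓝 I) :=
    tendsto_iff_dist_tendsto_zero.2 (squeeze_zero (fun _ => dist_nonneg) hdist
      tendsto_one_div_add_atTop_nhds_zero_nat)
  have hcauchy : CauchySeq u := by
    have := hlim.cauchySeq
    rw [Metric.cauchySeq_iff] at this ⊢
    exact this
  obtain ⟨β, hβ⟩ := cauchySeq_tendsto_of_complete hcauchy
  have hβI : β.complNonemptyCompacts = I := tendsto_nhds_unique
    ((isometry_complNonemptyCompacts.continuous.tendsto β).comp hβ) hlim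
  have : β.compl = Set.Icc 0 1 :=
    congrArg (fun K : TopologicalSpace.NonemptyCompacts ℝ => (K : Set ℝ)) hβI
  have h1 : volume β.compl = 0 := β.null_compl
  rw [this, Real.volume_Icc] at h1
  simp at h1

/-! ### Density of the partitions with diversity -/

/-- The count is bounded by the number of blocks while `h ^ α` tends to 0, so the diversity is 0. -/
theorem mem_withDiversity_of_finite {α : ℝ} (hα : 0 < α) (hβ : β.blocks.Finite) :
    β ∈ withDiversity α := by
  refine fun t _ => ⟨0, ?_⟩
  have hpow : Tendsto (fun h : ℝ => h ^ α) (𝓝[>] 0) (𝓝 0) := by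
    have := (Real.continuousAt_rpow_const 0 α (.inr hα.le)).tendsto.mono_left
      (nhdsWithin_le_nhds (s := Set.Ioi 0))
    rwa [Real.zero_rpow hα.ne'] at this
  have h1 : Tendsto (fun h : ℝ => h ^ α * (β.blockCount h t : ℝ)) (𝓝[>] 0) (𝓝 0) := by
    have h2 := hpow.mul_const (β.blocks.ncard : ℝ)
    rw [zero_mul] at h2
    refine squeeze_zero' ?_ ?_ h2
    · filter_upwards [self_mem_nhdsWithin] with h hh
      have : (0 : ℝ) < h := hh
      positivity
    · filter_upwards [self_mem_nhdsWithin] with h hh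
      have : (0 : ℝ) < h := hh
      gcongr
      exact Set.ncard_le_ncard (Set.sep_subset _ _) hβ
  simpa [HasDiversity] using h1.const_mul (Real.Gamma (1 - α))

theorem dense_withDiversity {α : ℝ} (hα : 0 < α) :
    @Dense IntervalPartition isMetric_dH'.topology (withDiversity α) := by
  rw [← topology_dH_eq]
  let _ := isMetric_dH.toMetricSpace
  refine fun β => Metric.mem_closure_iff.2 fun ε hε => ?_
  -- A finite net of the complement, with 0 added, is itself the complement of a partition with
  -- finitely many blocks.
  obtain ⟨P, hPsub, hPfin, hcover⟩ := β.isCompact_compl.finite_cover_balls (half_pos hε)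
  have hsub : insert 0 P ⊆ β.compl := Set.insert_subset β.zero_mem_compl hPsub
  have hfin := hPfin.insert 0
  let γ := ofFinite (insert 0 P) hfin (Set.mem_insert _ _)
    (hsub.trans fun x hx => (mem_compl_iff.1 hx).1.1)
  refine ⟨γ, mem_withDiversity_of_finite hα ((hfin.prod hfin).subset
    fun U hU => ⟨hU.1, hU.2.1⟩), ?_⟩
  refine lt_of_le_of_lt (b := ε / 2) ?_ (half_lt_self hε)
  change Metric.hausdorffDist β.compl γ.compl ≤ _
  rw [compl_ofFinite]
  refine Metric.hausdorffDist_le_of_mem_dist (half_pos hε).le (fun x hx => ?_)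
    (fun x hx => ⟨x, hsub hx, by simpa using (half_pos hε).le⟩)
  obtain ⟨y, hy, hxy⟩ := Set.mem_iUnion₂.1 (hcover hx)
  exact ⟨y, Set.mem_insert_of_mem _ hy, (Metric.mem_ball.1 hxy).le⟩

end IntervalPartition

/-! ### Convergence of monotone functions at all points -/

section Convergence

variable {f : ℕ → ℝ → ℝ}

/-- If monotone functions `f n` converge at all rationals but not at `t`, then the limit on the
rationals has a jump at `t`, which is isolated by a rational interval and a rational height. -/
theorem exists_isolated_jump (hmono : ∀ n, Monotone (f n)) {D : ℚ → ℝ}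
    (hD : ∀ q : ℚ, Tendsto (fun n => f n q) atTop (𝓝 (D q))) {t : ℝ}
    (ht : ¬ ∃ c, Tendsto (fun n => f n t) atTop (𝓝 c)) :
    ∃ p q η : ℚ, (p : ℝ) < t ∧ t < q ∧ D q - D p < 2 * η ∧
      ∀ p' q' : ℚ, (p' : ℝ) < t → t < q' → η ≤ D q' - D p' := by
  have hDmono : ∀ p q : ℚ, p ≤ q → D p ≤ D q := fun p q hpq =>
    le_of_tendsto_of_tendsto' (hD p) (hD q) fun n => hmono n (Rat.cast_le.2 hpq)
  have hle : ∀ p q : ℚ, (p : ℝ) < t → t < q → D p ≤ D q := fun p q hp hq =>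
    hDmono p q (Rat.cast_lt.1 (hp.trans hq)).le
  obtain ⟨p₀, hp₀⟩ := exists_rat_lt t
  obtain ⟨q₀, hq₀⟩ := exists_rat_gt t
  let A : Set ℝ := D '' {p | (p : ℝ) < t}
  let B : Set ℝ := D '' {q | t < (q : ℝ)}
  have hA : A.Nonempty := ⟨_, p₀, hp₀, rfl⟩
  have hB : B.Nonempty := ⟨_, q₀, hq₀, rfl⟩
  have hAb : BddAbove A := ⟨D q₀, by rintro _ ⟨p, hp, rfl⟩; exact hle p q₀ hp hq₀⟩
  have hBb : BddBelow B := ⟨D p₀, by rintro _ ⟨q, hq, rfl⟩; exact hle p₀ q hp₀ hq⟩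
  -- Without a jump, monotonicity squeezes `f n t` between rational values and forces convergence.
  have hlt : sSup A < sInf B := by
    by_contra! hge
    refine ht ⟨sSup A, tendsto_order.2 ⟨fun a ha => ?_, fun a ha => ?_⟩⟩
    · obtain ⟨_, ⟨p, hp, rfl⟩, hap⟩ := exists_lt_of_lt_csSup hA ha
      filter_upwards [(tendsto_order.1 (hD p)).1 a hap] with n hn
      exact hn.trans_le (hmono n hp.le)
    · obtain ⟨_, ⟨q, hq, rfl⟩, hqa⟩ := exists_lt_of_csInf_lt hB (hge.trans_lt ha)
      filter_upwards [(tendsto_order.1 (hD q)).2 a hqa] with n hn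
      exact (hmono n hq.le).trans_lt hn
  -- `η` lies strictly between half the jump and the jump; its excess over half the jump is the
  -- slack allowed on each side for `p` and `q`.
  obtain ⟨η, hη₁, hη₂⟩ := exists_rat_btwn
    (show (sInf B - sSup A) / 2 < sInf B - sSup A by linarith)
  obtain ⟨_, ⟨p, hp, rfl⟩, hpA⟩ := exists_lt_of_lt_csSup hA
    (show sSup A - (η - (sInf B - sSup A) / 2) < sSup A by linarith)
  obtain ⟨_, ⟨q, hq, rfl⟩, hqB⟩ := exists_lt_of_csInf_lt hB
    (show sInf B < sInf B + (η - (sInf B - sSup A) / 2) by linarith)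
  refine ⟨p, q, η, hp, hq, by linarith, fun p' q' hp' hq' => ?_⟩
  have h1 := le_csSup hAb ⟨p', hp', rfl⟩
  have h2 := csInf_le hBb ⟨q', hq', rfl⟩
  linarith

/-- The set of points where a sequence of jointly measurable functions, monotone in the real
variable, converges for all values of that variable is measurable: away from the rationals,
convergence can only fail at a jump of the limit, and isolated jumps are handled by the
Lusin–Souslin theorem. -/
theorem measurableSet_forall_exists_tendsto {X : Type*} [MeasurableSpace X]
    [StandardBorelSpace X] {f : ℕ → X → ℝ → ℝ}
    (hf : ∀ n, Measurable fun z : X × ℝ => f n z.1 z.2) (hmono : ∀ n x, Monotone (f n x)) :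
    MeasurableSet {x | ∀ t, ∃ c, Tendsto (fun n => f n x t) atTop (𝓝 c)} := by
  have hfq : ∀ (q : ℚ) n, Measurable fun x => f n x q := fun q n =>
    (hf n).comp (measurable_id.prodMk measurable_const)
  let E : Set X := {x | ∀ q : ℚ, ∃ c, Tendsto (fun n => f n x q) atTop (𝓝 c)}
  have hE : MeasurableSet E := by
    simp only [E, Set.ofPred_forall]
    exact MeasurableSet.iInter fun q => measurableSet_exists_tendsto (hfq q)
  -- The default values of `limUnder` off `E` are harmless, since `J` only involves points of `E`.
  let D : X → ℚ → ℝ := fun x q => limUnder atTop fun n => f n x q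
  have hDm : ∀ q, Measurable fun x : X => D x q := fun q =>
    (StronglyMeasurable.limUnder fun n => (hfq q n).stronglyMeasurable).measurable
  have hD : ∀ x ∈ E, ∀ q : ℚ, Tendsto (fun n => f n x q) atTop (𝓝 (D x q)) :=
    fun x hx q => tendsto_nhds_limUnder (hx q)
  let J : ℚ → ℚ → ℚ → Set (X × ℝ) := fun p q η =>
    {z | z.1 ∈ E} ∩ {z | (p : ℝ) < z.2} ∩ {z | z.2 < (q : ℝ)} ∩
      {z | D z.1 q - D z.1 p < 2 * η} ∩
      (⋂ p' : ℚ, ⋂ q' : ℚ,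
        ({z | (p' : ℝ) < z.2} ∩ {z | z.2 < (q' : ℝ)})ᶜ ∪ {z | (η : ℝ) ≤ D z.1 q' - D z.1 p'}) ∩
      {z | ∃ c, Tendsto (fun n => f n z.1 z.2) atTop (𝓝 c)}ᶜ
  have hJm : ∀ p q η, MeasurableSet (J p q η) := by
    intro p q η
    have hlt : ∀ p : ℚ, MeasurableSet {z : X × ℝ | (p : ℝ) < z.2} := fun p =>
      measurableSet_lt measurable_const measurable_snd
    have hgt : ∀ p : ℚ, MeasurableSet {z : X × ℝ | z.2 < (p : ℝ)} := fun p =>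
      measurableSet_lt measurable_snd measurable_const
    have hDD : ∀ p q : ℚ, Measurable fun z : X × ℝ => D z.1 q - D z.1 p := fun p q =>
      ((hDm q).comp measurable_fst).sub ((hDm p).comp measurable_fst)
    refine (((((measurable_fst hE).inter (hlt p)).inter (hgt q)).inter
      (measurableSet_lt (hDD p q) measurable_const)).inter ?_).inter
      (measurableSet_exists_tendsto hf).compl
    exact MeasurableSet.iInter fun p' => MeasurableSet.iInter fun q' =>
      ((hlt p').inter (hgt q')).compl.union (measurableSet_le measurable_const (hDD p' q'))
  have hJ : ∀ p q η z, z ∈ J p q η ↔ z.1 ∈ E ∧ (p : ℝ) < z.2 ∧ z.2 < (q : ℝ) ∧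
      D z.1 q - D z.1 p < 2 * η ∧
      (∀ p' q' : ℚ, (p' : ℝ) < z.2 → z.2 < q' → η ≤ D z.1 q' - D z.1 p') ∧
      ¬ ∃ c, Tendsto (fun n => f n z.1 z.2) atTop (𝓝 c) := by
    intro p q η z
    simp only [J, Set.mem_inter_iff, Set.mem_iInter, Set.mem_union, Set.mem_compl_iff,
      Set.mem_ofPred_eq, and_assoc, ← imp_iff_not_or, and_imp]
  have hinj : ∀ p q η, Set.InjOn Prod.fst (J p q η) := by
    have key : ∀ p q η x t t', (x, t) ∈ J p q η → (x, t') ∈ J p q η → t' ≤ t := by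
      intro p q η x t t' h h'
      obtain ⟨hx, hp, -, hpq, hj, -⟩ := (hJ _ _ _ _).1 h
      obtain ⟨-, -, hq, -, hj', -⟩ := (hJ _ _ _ _).1 h'
      by_contra! hlt
      -- A rational between two such points would split the increment from `p` to `q` into two parts
      -- of size at least `η`, but it is less than `2 * η`.
      obtain ⟨s, hs, hs'⟩ := exists_rat_btwn hlt
      have h1 := hj p s hp hs
      have h2 := hj' s q hs' hq
      simp only at hpq h1 h2
      linarith
    rintro p q η ⟨x, t⟩ hz ⟨x', t'⟩ hz' (rfl : x = x')
    exact Prod.ext rfl (le_antisymm (key p q η x t' t hz' hz) (key p q η x t t' hz hz'))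
  have heq : {x | ∀ t, ∃ c, Tendsto (fun n => f n x t) atTop (𝓝 c)} =
      E \ ⋃ p : ℚ, ⋃ q : ℚ, ⋃ η : ℚ, Prod.fst '' J p q η := by
    ext x
    constructor
    · refine fun hx => ⟨fun q => hx q, fun h => ?_⟩
      simp only [Set.mem_iUnion] at h
      obtain ⟨p, q, η, z, hz, rfl⟩ := h
      exact ((hJ _ _ _ _).1 hz).2.2.2.2.2 (hx z.2)
    · rintro ⟨hx, hxJ⟩ t
      by_contra ht
      obtain ⟨p, q, η, hp, hq, hpq, hj⟩ := exists_isolated_jump (fun n => hmono n x) (hD x hx) ht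
      refine hxJ ?_
      simp only [Set.mem_iUnion]
      exact ⟨p, q, η, (x, t), (hJ _ _ _ _).2 ⟨hx, hp, hq, hpq, hj, ht⟩, rfl⟩
  rw [heq]
  exact hE.diff (MeasurableSet.iUnion fun p => MeasurableSet.iUnion fun q =>
    MeasurableSet.iUnion fun η => (hJm p q η).image_of_measurable_injOn measurable_fst (hinj p q η))

/-- For an antitone nonnegative `N`, the limit of `h ^ α * N h` as `h ↓ 0` may be computed along
the sequence `1 / (n + 1)`. -/
theorem tendsto_rpow_mul_of_tendsto_seq {N : ℝ → ℝ} (hN : AntitoneOn N (Set.Ioi 0))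
    (hnn : ∀ h, 0 ≤ N h) {α c D : ℝ} (hα : 0 < α) (hc : 0 ≤ c)
    (hlim : Tendsto (fun n : ℕ => c * ((1 / ((n : ℝ) + 1)) ^ α * N (1 / ((n : ℝ) + 1)))) atTop
      (𝓝 D)) :
    Tendsto (fun h : ℝ => c * (h ^ α * N h)) (𝓝[>] 0) (𝓝 D) := by
  -- The shift to `1 / n` matches `n = ⌊h⁻¹⌋₊`, for which `1 / (n + 1) ≤ h ≤ 1 / n`; the ratio of
  -- these bounds tends to 1, and the value at `n = 0` is irrelevant.
  let G : ℕ → ℝ := fun n => c * ((1 / (n : ℝ)) ^ α * N (1 / n))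
  have hG1 : Tendsto (fun n => G (n + 1)) atTop (𝓝 D) := by
    simpa only [G, Nat.cast_add, Nat.cast_one] using hlim
  have hG : Tendsto G atTop (𝓝 D) := (tendsto_add_atTop_iff_nat 1).1 hG1
  have hratio : Tendsto (fun n : ℕ => ((n : ℝ) / (n + 1)) ^ α) atTop (𝓝 1) := by
    have := (tendsto_natCast_div_add_atTop (1 : ℝ)).rpow_const (p := α) (.inl one_ne_zero)
    rwa [Real.one_rpow] at this
  have hlow : Tendsto (fun n : ℕ => ((n : ℝ) / (n + 1)) ^ α * G n) atTop (𝓝 D) := by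
    simpa using hratio.mul hG
  have hup : Tendsto (fun n : ℕ => (((n : ℝ) / (n + 1)) ^ α)⁻¹ * G (n + 1)) atTop (𝓝 D) := by
    simpa using (hratio.inv₀ one_ne_zero).mul hG1
  have hfloor : Tendsto (fun h : ℝ => ⌊h⁻¹⌋₊) (𝓝[>] 0) atTop :=
    tendsto_nat_floor_atTop.comp tendsto_inv_nhdsGT_zero
  refine tendsto_of_tendsto_of_tendsto_of_le_of_le' (hlow.comp hfloor) (hup.comp hfloor) ?_ ?_
  all_goals
    filter_upwards [Ioo_mem_nhdsGT (zero_lt_one' ℝ)] with h hh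
    have hh0 : 0 < h := hh.1
    have h1 : 1 ≤ h⁻¹ := (one_le_inv₀ hh0).2 hh.2.le
    simp only [Function.comp_apply]
    have hn1 : 1 ≤ ⌊h⁻¹⌋₊ := Nat.one_le_floor_iff _ |>.2 h1
    have hfl := Nat.floor_le (inv_nonneg.2 hh0.le)
    have hfu := Nat.lt_floor_add_one h⁻¹
    generalize ⌊h⁻¹⌋₊ = n at hn1 hfl hfu
    have hn : (0 : ℝ) < n := Nat.cast_pos.2 hn1
    have hhn : h ≤ 1 / n := by rw [le_div_comm₀ hh0 hn, one_div]; exact hfl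
    have hhn' : 1 / ((n : ℝ) + 1) ≤ h := by
      rw [div_le_comm₀ (by positivity) hh0, one_div]; exact hfu.le
  · have e : ((n : ℝ) / (n + 1)) ^ α * G n = c * ((1 / ((n : ℝ) + 1)) ^ α * N (1 / n)) := by
      have : (1 / ((n : ℝ) + 1)) ^ α = ((n : ℝ) / (n + 1)) ^ α * (1 / (n : ℝ)) ^ α := by
        rw [← Real.mul_rpow (by positivity) (by positivity)]
        congr 1
        field_simp
      simp only [G]
      rw [this]
      ring
    rw [e]
    have hNle : N (1 / n) ≤ N h := hN hh0 (Set.mem_Ioi.2 (by positivity)) hhn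
    have := hnn (1 / n)
    gcongr
  · have e : (((n : ℝ) / (n + 1)) ^ α)⁻¹ * G (n + 1) =
        c * ((1 / (n : ℝ)) ^ α * N (1 / ((n : ℝ) + 1))) := by
      have : (1 / (n : ℝ)) ^ α = (((n : ℝ) / (n + 1)) ^ α)⁻¹ * (1 / ((n : ℝ) + 1)) ^ α := by
        rw [← Real.inv_rpow (by positivity), ← Real.mul_rpow (by positivity) (by positivity)]
        congr 1
        field_simp
      simp only [G, Nat.cast_add, Nat.cast_one]
      rw [this]
      ring
    rw [e]
    have hNle : N h ≤ N (1 / ((n : ℝ) + 1)) := hN (Set.mem_Ioi.2 (by positivity)) hh0 hhn'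
    have := hnn h
    gcongr

end Convergence

namespace IntervalPartition

variable {β : IntervalPartition} {h t : ℝ}

/-! ### Measurability of the block counts -/

theorem finite_setOf_lt_length (β : IntervalPartition) (hh : 0 < h) :
    {U ∈ β.blocks | h < U.2 - U.1}.Finite := by
  by_contra hinf
  obtain ⟨n, hn⟩ := exists_nat_gt (β.mass / h)
  obtain ⟨F, hF, hcard⟩ := Set.Infinite.exists_subset_card_eq hinf n
  have h1 : ∑ _U ∈ F, h ≤ ∑ U ∈ F, blockLeb U := Finset.sum_le_sum fun U hU => (hF hU).2.le
  have h2 := sum_blockLeb_le_mass (β := β) (F := F) fun U hU => (hF hU).1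
  rw [Finset.sum_const, hcard, nsmul_eq_mul] at h1
  rw [div_lt_iff₀ hh] at hn
  linarith

/-- The number of blocks `(a, b)` with `b - a > h` and `b < t`. -/
noncomputable def strictBlockCount (β : IntervalPartition) (h t : ℝ) : ℕ :=
  {U ∈ β.blocks | h < U.2 - U.1 ∧ U.2 < t}.ncard

theorem finite_setOf_strictBlockCount (β : IntervalPartition) (hh : 0 < h) (t : ℝ) :
    {U ∈ β.blocks | h < U.2 - U.1 ∧ U.2 < t}.Finite :=
  (β.finite_setOf_lt_length hh).subset fun _ hU => ⟨hU.1, hU.2.1⟩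

theorem finite_setOf_blockCount (β : IntervalPartition) (hh : 0 < h) (t : ℝ) :
    {U ∈ β.blocks | h < U.2 - U.1 ∧ U.2 ≤ t}.Finite :=
  (β.finite_setOf_lt_length hh).subset fun _ hU => ⟨hU.1, hU.2.1⟩

/-- This is joint lower semicontinuity in `(β, t)`: the finitely many counted blocks satisfy strict
inequalities, which survive small perturbations. The condition `U.2 ≤ t` would not. -/
theorem exists_le_strictBlockCount (β : IntervalPartition) (hh : 0 < h) (t : ℝ) :
    ∃ r > 0, ∀ γ s, dH β γ < r → |t - s| < r → β.strictBlockCount h t ≤ γ.strictBlockCount h s := by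
  let F := (β.finite_setOf_strictBlockCount hh t).toFinset
  have hF : ∀ U, U ∈ F ↔ U ∈ β.blocks ∧ h < U.2 - U.1 ∧ U.2 < t := fun U =>
    Set.Finite.mem_toFinset _
  -- The slack is `2 * r` because two quantities move by less than `r`: the two ends of the block,
  -- or its right end and `t`.
  obtain ⟨r₁, hr₁, hmin⟩ : ∃ r > 0, ∀ U ∈ F, h + 2 * r ≤ U.2 - U.1 ∧ U.2 + 2 * r ≤ t := by
    rcases F.eq_empty_or_nonempty with he | hne
    · exact ⟨1, one_pos, by simp [he]⟩
    · obtain ⟨W, hW, hW'⟩ := F.exists_min_image (fun U => min (U.2 - U.1 - h) (t - U.2)) hne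
      have hpos : 0 < min (W.2 - W.1 - h) (t - W.2) :=
        lt_min (by linarith [((hF W).1 hW).2.1]) (by linarith [((hF W).1 hW).2.2])
      refine ⟨min (W.2 - W.1 - h) (t - W.2) / 2, half_pos hpos, fun U hU => ?_⟩
      have := le_min_iff.1 (hW' U hU)
      constructor <;> linarith [this.1, this.2]
  obtain ⟨r₀, hr₀, H⟩ := exists_near_blocks (β := β) (F := F) fun U hU => ((hF U).1 hU).1
  refine ⟨min r₀ r₁, lt_min hr₀ hr₁, fun γ s hγ hs => ?_⟩
  obtain ⟨v, hv, hord⟩ := H _ (min_le_left _ _) γ hγ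
  have hr := min_le_right r₀ r₁
  rw [strictBlockCount, Set.ncard_eq_toFinset_card _ (β.finite_setOf_strictBlockCount hh t),
    strictBlockCount, Set.ncard_eq_toFinset_card _ (γ.finite_setOf_strictBlockCount hh s)]
  refine Finset.card_le_card_of_injOn v (fun U hU => ?_) fun U hU W hW hUW => ?_
  · obtain ⟨h1, h2, h3⟩ := hv U hU
    obtain ⟨h4, h5⟩ := hmin U hU
    rw [abs_lt] at h2 h3 hs
    refine Finset.mem_coe.2 ((Set.Finite.mem_toFinset _).2 ⟨h1, ?_, ?_⟩) <;> linarith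
  · by_contra hne
    have hlt := γ.lt_of_mem _ (hv U hU).1
    rcases snd_le_fst_or ((hF U).1 hU).1 ((hF W).1 hW).1 hne with h1 | h1
    · have := hord U hU W hW h1
      rw [← hUW] at this
      linarith
    · have := hord W hW U hU h1
      rw [← hUW] at this
      linarith

/-- Only finitely many blocks are longer than `h`, so a right end beyond `t` is eventually beyond `t
+ 1 / (m + 1)` for all of them at once. -/
theorem eventually_strictBlockCount_eq (β : IntervalPartition) (hh : 0 < h) (t : ℝ) :
    ∀ᶠ m : ℕ in atTop, β.strictBlockCount h (t + 1 / ((m : ℝ) + 1)) = β.blockCount h t := by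
  have hev : ∀ U ∈ {U ∈ β.blocks | h < U.2 - U.1}, ∀ᶠ m : ℕ in atTop,
      (U.2 < t + 1 / ((m : ℝ) + 1) ↔ U.2 ≤ t) := by
    intro U _
    rcases le_or_gt U.2 t with hle | hgt
    · filter_upwards with m
      have : (0 : ℝ) < 1 / ((m : ℝ) + 1) := by positivity
      exact iff_of_true (by linarith) hle
    · filter_upwards [(tendsto_order.1 (tendsto_one_div_add_atTop_nhds_zero_nat (𝕜 := ℝ))).2
        (U.2 - t) (by linarith)] with m hm
      exact iff_of_false (by linarith) hgt.not_ge
  filter_upwards [(eventually_all_finite (β.finite_setOf_lt_length hh)).2 hev] with m hm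
  rw [strictBlockCount, blockCount]
  congr 1
  ext U
  exact ⟨fun hU => ⟨hU.1, hU.2.1, (hm U ⟨hU.1, hU.2.1⟩).1 hU.2.2⟩,
    fun hU => ⟨hU.1, hU.2.1, (hm U ⟨hU.1, hU.2.1⟩).2 hU.2.2⟩⟩

theorem blockCount_mono (β : IntervalPartition) (hh : 0 < h) : Monotone (β.blockCount h) :=
  fun _ t hst => Set.ncard_le_ncard (fun _ hU => ⟨hU.1, hU.2.1, hU.2.2.trans hst⟩)
    (β.finite_setOf_blockCount hh t)

theorem blockCount_antitoneOn (β : IntervalPartition) (t : ℝ) :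
    AntitoneOn (fun h => (β.blockCount h t : ℝ)) (Set.Ioi 0) :=
  fun _ hh _ _ hle => Nat.cast_le.2 (Set.ncard_le_ncard
    (fun _ hU => ⟨hU.1, hle.trans_lt hU.2.1, hU.2.2⟩) (β.finite_setOf_blockCount hh t))

theorem blockCount_of_neg (ht : t < 0) (h : ℝ) : β.blockCount h t = 0 := by
  have : {U ∈ β.blocks | h < U.2 - U.1 ∧ U.2 ≤ t} = ∅ := Set.eq_empty_of_forall_notMem
    fun U hU => by linarith [fst_nonneg hU.1, β.lt_of_mem U hU.1, hU.2.2]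
  rw [blockCount, this, Set.ncard_empty]

theorem blockCount_of_mass_le (ht : β.mass ≤ t) (h : ℝ) :
    β.blockCount h t = β.blockCount h β.mass := by
  rw [blockCount, blockCount]
  congr 1
  ext U
  exact ⟨fun hU => ⟨hU.1, hU.2.1, snd_le_mass hU.1⟩, fun hU => ⟨hU.1, hU.2.1, hU.2.2.trans ht⟩⟩

/-- The quantity whose limit along `h = 1 / (n + 1)` is the diversity. -/
noncomputable def diversityApprox (α : ℝ) (n : ℕ) (β : IntervalPartition) (t : ℝ) : ℝ :=
  Real.Gamma (1 - α) * ((1 / ((n : ℝ) + 1)) ^ α * (β.blockCount (1 / ((n : ℝ) + 1)) t : ℝ))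

/-! ### Borel measurability of the set of partitions with diversity -/

theorem exists_hasDiversity_iff {α : ℝ} (h0 : 0 < α) (h1 : α < 1) :
    (∃ D, HasDiversity α β t D) ↔
      ∃ D, Tendsto (fun n => diversityApprox α n β t) atTop (𝓝 D) := by
  refine exists_congr fun D => ⟨fun h => ?_, fun h => ?_⟩
  · refine h.comp (tendsto_nhdsWithin_iff.2 ⟨tendsto_one_div_add_atTop_nhds_zero_nat, ?_⟩)
    exact Eventually.of_forall fun n => Set.mem_Ioi.2 (by positivity)
  · exact tendsto_rpow_mul_of_tendsto_seq (β.blockCount_antitoneOn t) (fun _ => Nat.cast_nonneg _)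
      h0 (Real.Gamma_pos_of_pos (by linarith)).le h

/-- Counts are constant in `t` on each side of `[0, β.mass]`, so the range of `t`, which depends on
`β`, can be replaced by the whole line. -/
theorem withDiversity_eq {α : ℝ} (h0 : 0 < α) (h1 : α < 1) :
    withDiversity α =
      {β | ∀ t, ∃ D, Tendsto (fun n => diversityApprox α n β t) atTop (𝓝 D)} := by
  ext β
  refine ⟨fun hβ t => ?_, fun hβ t _ => (exists_hasDiversity_iff h0 h1).2 (hβ t)⟩
  rcases lt_or_ge t 0 with ht | ht
  · refine ⟨0, ?_⟩
    simp only [diversityApprox, blockCount_of_neg ht, Nat.cast_zero, mul_zero]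
    exact tendsto_const_nhds
  · rcases le_total t β.mass with htm | htm
    · exact (exists_hasDiversity_iff h0 h1).1 (hβ t ⟨ht, htm⟩)
    · simp only [diversityApprox, blockCount_of_mass_le htm]
      exact (exists_hasDiversity_iff h0 h1).1 (hβ β.mass ⟨β.mass_nonneg, le_rfl⟩)

theorem measurableSet_withDiversity {α : ℝ} (h0 : 0 < α) (h1 : α < 1) :
    @MeasurableSet IntervalPartition (@borel IntervalPartition isMetric_dH'.topology)
      (withDiversity α) := by
  have hpolish : @PolishSpace IntervalPartition isMetric_dH'.topology := by
    let _ := isMetric_dH'.toMetricSpace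
    have : CompleteSpace IntervalPartition := isComplete_dH'
    have : TopologicalSpace.SeparableSpace IntervalPartition := separableSpace_dH'
    have : SecondCountableTopology IntervalPartition :=
      UniformSpace.secondCountable_of_separable _
    infer_instance
  -- Polishness comes from the complete metric `dH'`, but the semicontinuity of the counts is stated
  -- for `dH`.
  rw [← topology_dH_eq] at hpolish ⊢
  let _ := isMetric_dH.toMetricSpace
  have _ : PolishSpace IntervalPartition := hpolish
  let _ : MeasurableSpace IntervalPartition := borel IntervalPartition
  have _ : BorelSpace IntervalPartition := ⟨rfl⟩
  have hstrict : ∀ h > 0, Measurable fun z : IntervalPartition × ℝ =>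
      z.1.strictBlockCount h z.2 := by
    refine fun h hh => measurable_of_Ici fun k => IsOpen.measurableSet ?_
    refine Metric.isOpen_iff.2 fun ⟨β, t⟩ hk => ?_
    obtain ⟨r, hr, H⟩ := β.exists_le_strictBlockCount hh t
    refine ⟨r, hr, fun ⟨γ, s⟩ hz => ?_⟩
    rw [Metric.mem_ball, dist_comm, Prod.dist_eq, max_lt_iff] at hz
    exact le_trans (Set.mem_Ici.1 hk) (H γ s hz.1 hz.2)
  have hcount : ∀ h > 0, Measurable fun z : IntervalPartition × ℝ => z.1.blockCount h z.2 := by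
    refine fun h hh => measurable_of_tendsto_metrizable
      (f := fun (m : ℕ) z => z.1.strictBlockCount h (z.2 + 1 / ((m : ℝ) + 1))) (fun m => ?_) ?_
    · exact (hstrict h hh).comp (measurable_fst.prodMk (measurable_snd.add_const _))
    · exact tendsto_pi_nhds.2 fun z => tendsto_const_nhds.congr'
        ((z.1.eventually_strictBlockCount_eq hh z.2).mono fun _ h => h.symm)
  rw [withDiversity_eq h0 h1]
  refine measurableSet_forall_exists_tendsto (fun n => ?_) fun n β s t hst => ?_
  · have hm := hcount (1 / ((n : ℝ) + 1)) (by positivity)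
    exact ((measurable_from_top.comp hm).const_mul _).const_mul _
  · have hG := (Real.Gamma_pos_of_pos (sub_pos.2 h1)).le
    have := β.blockCount_mono (h := 1 / ((n : ℝ) + 1)) (by positivity) hst
    simp only [diversityApprox]
    gcongr

end IntervalPartition

theorem theorem1 :
    ∃ (h' : IsMetric IntervalPartition.dH') (h : IsMetric IntervalPartition.dH),
      (h.topology = h'.topology ∧
        @TopologicalSpace.SeparableSpace IntervalPartition h'.topology) ∧
      (h'.IsComplete ∧ ¬ h.IsComplete) ∧
      (∀ α : ℝ, 0 < α → α < 1 →
        @MeasurableSet IntervalPartition (@borel IntervalPartition h'.topology)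
          (IntervalPartition.withDiversity α) ∧
        @Dense IntervalPartition h'.topology (IntervalPartition.withDiversity α)) :=
  ⟨IntervalPartition.isMetric_dH', IntervalPartition.isMetric_dH,
    ⟨IntervalPartition.topology_dH_eq, IntervalPartition.separableSpace_dH'⟩,
    ⟨IntervalPartition.isComplete_dH', IntervalPartition.not_isComplete_dH⟩,
    fun _ h0 h1 => ⟨IntervalPartition.measurableSet_withDiversity h0 h1,
      IntervalPartition.dense_withDiversity h0⟩⟩
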